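/- Let $p_1,\dots,p_n$ be the vertices of a convex polygon in the plane, listed in the order in which they appear on its clockwise oriented boundary (for $n\le 2$: distinct points), and identify them with $[n]=\{1,\dots,n\}$. *Definitions.* A hypergraph on $[n]$ is a set of hyperedges, i.e. of subsets of $[n]$ with at least two elements. It is a *hyperforest* if it has no simple cycle $(v_0,e_1,v_1,\dots,e_k,v_k=v_0)$ with $k\ge 2$, where the vertices $v_0,\dots,v_{k-1}$ are distinct, the hyperedges $e_1,\dots,e_k$ are distinct, and $v_{i-1},v_i\in e_i$ for each $i$; it is *noncrossing* if the convex hulls of any two distinct hyperedges have at most one vertex, and no other point, in common. A hypergraph with pairwise disjoint hyperedges is a *partition* (vertices in no hyperedge are singleton blocks). To a hyperedge $e=\{a_1<\dots<a_m\}$ belongs the cycle $\sigma_e=(a_1,a_2,\dots,a_m)$, and to a noncrossing partition the product of the pairwise commuting cycles of its hyperedges; the permutations so obtained are the *noncrossing permutations*. The noncrossing permutation of a noncrossing hyperforest $\tau$ is that of the partition of $[n]$ into the connected components of $\tau$. At each vertex $v$ the hyperedges of $\tau$ containing $v$ are linearly ordered from left to right, as seen from $v$ looking into the polygon; the *hyperedge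 poset* of $\tau$ is the set of its hyperedges with the partial order generated by the covering relations of all these local orders. A *properly ordered* noncrossing hyperforest is a noncrossing hyperforest together with a linear ordering of its hyperedges that is a linear extension of its hyperedge poset. A permutation is *irreducible* if it is a single cycle of length at least $2$. The reflection length $\ell_R(\sigma)$ is the least number of transpositions with product $\sigma$. Products of permutations are taken from left to right (the first factor is applied first), and a factorization $\sigma=\sigma_1\sigma_2\cdots\sigma_k$ ($k\ge 0$) is *reduced* if $\ell_R(\sigma)=\sum_{i=1}^k\ell_R(\sigma_i)$. **Theorem.** For each noncrossing permutation $\sigma$ of $[n]$ there is a natural bijection between the set of reduced factorizations of $\sigma$ into irreducible permutations and the set of properly ordered noncrossing hyperforests $\tau$ with $\sigma$ as their noncrossing permutation. It sends $(\sigma_1,\dots,\sigma_k)$ to the hyperforest whose hyperedges are, in this order, the sets of elements moved by $\sigma_1,\dots,\sigma_k$, and its inverse sends $\tau$ with hyperedges $e_1,\dots,e_k$ in this order to $(\sigma_{e_1},\dots,\sigma_{e_k})$. -/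

import Mathlib

namespace NCHyperforest

/-! ### Hypergraphs, hyperforests and their partitions -/

/-- A hypergraph on the vertex set `Fin n`: a set of hyperedges, each with at least two vertices. -/
@[ext]
structure HGraph (n : ℕ) where
  edges : Finset (Finset (Fin n))
  two_le_card : ∀ e ∈ edges, 2 ≤ e.card

namespace HGraph

variable {n : ℕ}

/-- A nontrivial simple cycle `(v 0, e 0, v 1, e 1, …, e (k-1), v k)` of length `k ≥ 2`: every
`e i` is a hyperedge containing `v i` and `v (i+1)`, the endpoints `v 0` and `v k` are equal, and
otherwise all the vertices and all the hyperedges are distinct. -/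
def HasSimpleCycle (τ : HGraph n) : Prop :=
  ∃ k : ℕ, 2 ≤ k ∧ ∃ (v : ℕ → Fin n) (e : ℕ → Finset (Fin n)),
    v k = v 0 ∧ Set.InjOn v (Set.Iio k) ∧ Set.InjOn e (Set.Iio k) ∧
    ∀ i < k, e i ∈ τ.edges ∧ v i ∈ e i ∧ v (i + 1) ∈ e i

/-- A hyperforest is a hypergraph without nontrivial simple cycles. -/
def IsHyperforest (τ : HGraph n) : Prop := ¬ τ.HasSimpleCycle

/-- A hypergraph with pairwise disjoint hyperedges, viewed as the set partition whose blocks are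
the hyperedges together with the singletons of the remaining vertices. -/
def IsPartition (τ : HGraph n) : Prop :=
  ∀ e ∈ τ.edges, ∀ f ∈ τ.edges, e ≠ f → Disjoint e f

/-- `u` and `w` are the endpoints of a path. -/
def Reachable (τ : HGraph n) : Fin n → Fin n → Prop :=
  Relation.ReflTransGen (fun a b => ∃ e ∈ τ.edges, a ∈ e ∧ b ∈ e)

open Classical in
/-- The vertex set of the connected component of `v`. -/
noncomputable def component (τ : HGraph n) (v : Fin n) : Finset (Fin n) :=
  Finset.univ.filter (fun w => τ.Reachable v w)

open Classical in
/-- The partition of `τ`: its blocks are the vertex sets of the connected components of `τ`, and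
the blocks with at least two vertices are its hyperedges. -/
noncomputable def partition (τ : HGraph n) : HGraph n where
  edges := (Finset.univ.image τ.component).filter (fun b => 2 ≤ b.card)
  two_le_card := fun _ he => (Finset.mem_filter.mp he).2

theorem Reachable.symm {τ : HGraph n} {u w : Fin n} (h : τ.Reachable u w) : τ.Reachable w u := by
  induction h with
  | refl => exact Relation.ReflTransGen.refl
  | tail _ hbc ih =>
    obtain ⟨e, he, hb, hc⟩ := hbc
    exact Relation.ReflTransGen.head ⟨e, he, hc, hb⟩ ih

theorem isPartition_partition (τ : HGraph n) : τ.partition.IsPartition := by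
  classical
  intro e he f hf hef
  obtain ⟨v, -, rfl⟩ := Finset.mem_image.mp (Finset.mem_filter.mp he).1
  obtain ⟨w, -, rfl⟩ := Finset.mem_image.mp (Finset.mem_filter.mp hf).1
  rw [Finset.disjoint_left]
  intro x hx hy
  apply hef
  have hx' : τ.Reachable v x := (Finset.mem_filter.mp hx).2
  have hy' : τ.Reachable w x := (Finset.mem_filter.mp hy).2
  ext y
  simp only [component, Finset.mem_filter, Finset.mem_univ, true_and]
  exact ⟨fun h => hy'.trans (hx'.symm.trans h), fun h => hx'.trans (hy'.symm.trans h)⟩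

end HGraph

/-! ### Convex polygons and noncrossing hypergraphs -/

/-- The points `p 0, p 1, …, p (n-1)` are the vertices of a convex polygon in the plane, in the
order in which they appear on its clockwise oriented boundary: they are distinct, and every
triple `p i, p j, p k` with `i < j < k` is a clockwise oriented, nondegenerate triangle.
(For `n ≤ 2` this only says that the points are distinct.) -/
def IsClockwiseConvexPolygon {n : ℕ} (p : Fin n → EuclideanSpace ℝ (Fin 2)) : Prop :=
  Function.Injective p ∧ ∀ i j k : Fin n, i < j → j < k →
    (p j 0 - p i 0) * (p k 1 - p i 1) - (p j 1 - p i 1) * (p k 0 - p i 0) < 0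

section Polygon

variable {n : ℕ} (p : Fin n → EuclideanSpace ℝ (Fin 2))

/-- The convex hulls of `e` and `f` have at most one vertex, and no other point, in common. -/
def WeaklyNoncrossing (e f : Finset (Fin n)) : Prop :=
  convexHull ℝ (p '' (e : Set (Fin n))) ∩ convexHull ℝ (p '' (f : Set (Fin n))) = ∅ ∨
  ∃ v : Fin n,
    convexHull ℝ (p '' (e : Set (Fin n))) ∩ convexHull ℝ (p '' (f : Set (Fin n))) = {p v}

/-- A noncrossing hypergraph: its hyperedges are pairwise weakly noncrossing. -/
def HGraph.IsNoncrossing (τ : HGraph n) : Prop :=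
  ∀ e ∈ τ.edges, ∀ f ∈ τ.edges, e ≠ f → WeaklyNoncrossing p e f

/-- Seen from the point `p v`, the point `p a` is to the left of the point `p b`: the triangle
`p v, p b, p a` is counterclockwise oriented. -/
def IsLeftOf (v a b : Fin n) : Prop :=
  0 < (p b 0 - p v 0) * (p a 1 - p v 1) - (p b 1 - p v 1) * (p a 0 - p v 0)

/-- The local linear order at `v` on the hyperedges containing `v`: `e < f` if and only if `e`
is to the left of `f` from the perspective of `v` looking towards the interior of the polygon. -/
def HGraph.LocalLT (τ : HGraph n) (v : Fin n) (e f : Finset (Fin n)) : Prop :=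
  e ∈ τ.edges ∧ f ∈ τ.edges ∧ e ≠ f ∧ v ∈ e ∧ v ∈ f ∧
    ∀ a ∈ e, a ≠ v → ∀ b ∈ f, b ≠ v → IsLeftOf p v a b

/-- The covering relations of the local linear order at `v`. -/
def HGraph.LocalCovBy (τ : HGraph n) (v : Fin n) (e f : Finset (Fin n)) : Prop :=
  τ.LocalLT p v e f ∧ ∀ g, ¬ (τ.LocalLT p v e g ∧ τ.LocalLT p v g f)

/-- The order relation of the hyperedge poset of `τ`: the reflexive and transitive closure of the
covering relations of the local linear orders at all the vertices. -/
def HGraph.PosetLE (τ : HGraph n) : Finset (Fin n) → Finset (Fin n) → Prop :=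
  Relation.ReflTransGen (fun e f => ∃ v, τ.LocalCovBy p v e f)

end Polygon

/-! ### Permutations -/

/-- The irreducible permutation of a hyperedge: the cycle that lists the vertices of `e` in their
clockwise boundary order, which is their natural order in the standard labelling. -/
def edgePerm {n : ℕ} (e : Finset (Fin n)) : Equiv.Perm (Fin n) :=
  (e.sort (· ≤ ·)).formPerm

theorem disjoint_edgePerm {n : ℕ} {e f : Finset (Fin n)} (h : Disjoint e f) :
    (edgePerm e).Disjoint (edgePerm f) := by
  intro x
  by_contra! hx
  have h1 := List.mem_of_formPerm_apply_ne hx.1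
  have h2 := List.mem_of_formPerm_apply_ne hx.2
  rw [Finset.mem_sort] at h1 h2
  exact Finset.disjoint_left.mp h h1 h2

/-- The permutation of a partition: the product of the pairwise commuting irreducible permutations
of its hyperedges. -/
noncomputable def partitionPerm {n : ℕ} (π : HGraph n) (hπ : π.IsPartition) :
    Equiv.Perm (Fin n) :=
  π.edges.noncommProd edgePerm
    (fun e he f hf hef => (disjoint_edgePerm (hπ e he f hf hef)).commute)

/-- A noncrossing permutation is the permutation of a noncrossing partition. -/
def IsNoncrossingPerm {n : ℕ} (p : Fin n → EuclideanSpace ℝ (Fin 2))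
    (σ : Equiv.Perm (Fin n)) : Prop :=
  ∃ (π : HGraph n) (hπ : π.IsPartition), π.IsNoncrossing p ∧ σ = partitionPerm π hπ

/-- The noncrossing permutation of a noncrossing hyperforest `τ`: the permutation of the
partition of `τ`. -/
noncomputable def HGraph.noncrossingPerm {n : ℕ} (τ : HGraph n) : Equiv.Perm (Fin n) :=
  partitionPerm τ.partition τ.isPartition_partition

/-! ### Ordered hyperforests -/

/-- An ordered hyperforest: a hyperforest with a linear ordering of its hyperedges, given as the
list of the hyperedges in increasing order. -/
@[ext]
structure OrderedHyperforest (n : ℕ) extends HGraph n where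
  isHyperforest : toHGraph.IsHyperforest
  order : List (Finset (Fin n))
  nodup : order.Nodup
  mem_order : ∀ e, e ∈ order ↔ e ∈ edges

/-- A properly ordered noncrossing hyperforest: the linear ordering of the hyperedges is a linear
extension of the hyperedge poset. -/
def OrderedHyperforest.IsProperNoncrossing {n : ℕ} (p : Fin n → EuclideanSpace ℝ (Fin 2))
    (τ : OrderedHyperforest n) : Prop :=
  τ.toHGraph.IsNoncrossing p ∧
    ∀ e ∈ τ.edges, ∀ f ∈ τ.edges, τ.toHGraph.PosetLE p e f →
      τ.order.idxOf e ≤ τ.order.idxOf f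

/-! ### Reduced factorizations -/

/-- Reflection length: the smallest length of a list of transpositions with product `σ`. -/
noncomputable def reflectionLength {n : ℕ} (σ : Equiv.Perm (Fin n)) : ℕ :=
  sInf {m : ℕ | ∃ L : List (Equiv.Perm (Fin n)),
    (∀ r ∈ L, r.IsSwap) ∧ L.prod = σ ∧ L.length = m}

/-- The product `σ₁ σ₂ ⋯ σₖ` of a list of permutations, multiplied from left to right (apply `σ₁`
first). The multiplication of `Equiv.Perm` is composition from right to left, hence the reversal.
-/
def leftToRightProd {n : ℕ} (L : List (Equiv.Perm (Fin n))) : Equiv.Perm (Fin n) :=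
  L.reverse.prod

/-- `L = [σ₁, …, σₖ]` is a reduced factorization of `σ` into irreducible permutations: each factor
is a single cycle of length at least two, the product is `σ`, and the reflection lengths add up. -/
def IsReducedIrreducibleFactorization {n : ℕ} (σ : Equiv.Perm (Fin n))
    (L : List (Equiv.Perm (Fin n))) : Prop :=
  (∀ s ∈ L, s.IsCycle) ∧ leftToRightProd L = σ ∧
    reflectionLength σ = (L.map reflectionLength).sum

end NCHyperforest

namespace NCHyperforest

open Equiv Equiv.Perm

variable {n : ℕ}

/-! Everything is encoded in a relation on four points: `Uncrossed x y a b` says that the half-open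
cyclic interval `(x, y]` contains both or neither of `a`, `b`. It is an equivalence relation in `a,
b` for fixed `x, y`, and in `x, y` for fixed `a, b`, so it only has to be checked on generating
pairs. Both sides of the bijection turn out to be the same data: lists of sets with at least two
elements, each in relation `Precedes` to all later ones, whose cycles have product `σ`.

Permutations: reflection length is `n` minus the number of cycles. In a product of transpositions
each uncrossed with the later ones, every transposition merges two cycles, so the product is
noncrossing and the factorization is shortest (`UncrossedList.swapProd_spec`). Conversely, peeling
transpositions off a shortest factorization of a noncrossing permutation splits a cycle each time,
which forces the list to be uncrossed (`uncrossedList_of_length_eq`). Expanding each factor into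
transpositions turns this into the statements on hyperedges, `reflectionLength_leftToRightProd` and
`reduced_factorization_spec`. Noncrossing permutations are determined by their cycles as sets, so
every factor is the cycle of its support and the product is the permutation of the connected
components (`noncrossingPerm_eq`).

Geometry: for disjoint hyperedges `Precedes` means that no diagonals cross; for hyperedges with a
common vertex it also records which one is on the left. Hence proper noncrossing orders are the
lists that are pairwise `Precedes` (`proper_iff_pairwise`). Acyclicity is then automatic
(`isHyperforest_of_pairwise`). -/

theorem leftToRightProd_cons (s : Perm (Fin n)) (L : List (Perm (Fin n))) :
    leftToRightProd (s :: L) = leftToRightProd L * s := by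
  simp [leftToRightProd]

theorem leftToRightProd_append (L M : List (Perm (Fin n))) :
    leftToRightProd (L ++ M) = leftToRightProd M * leftToRightProd L := by
  simp [leftToRightProd]

/-! ### Cycles under multiplication by a transposition -/

theorem sameCycle_rec {w : Perm (Fin n)} {r : Fin n → Fin n → Prop} (refl : ∀ x, r x x)
    (trans : ∀ x y z, r x y → r y z → r x z) (step : ∀ x, r x (w x)) {x y : Fin n}
    (h : w.SameCycle x y) : r x y := by
  obtain ⟨k, -, rfl⟩ := h.exists_pow_eq'
  clear h
  induction k with
  | zero => exact refl x
  | succ k ih =>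
    rw [pow_succ', Perm.mul_apply]
    exact trans _ _ _ ih (step _)

theorem sameCycle_apply_self (w : Perm (Fin n)) (x : Fin n) : w.SameCycle x (w x) :=
  sameCycle_apply_right.2 (SameCycle.refl _ _)

/-- Multiplying by a transposition joins two different cycles into one. -/
theorem sameCycle_mul_swap {w : Perm (Fin n)} {a b : Fin n} (h : ¬ w.SameCycle a b) :
    (w * swap a b).SameCycle a b := by
  -- The new orbit of `a` jumps to `w b` and then follows the old cycle of `b`, which avoids `a`,
  -- until it reaches `b` itself.
  have key : ∀ j : ℕ, (w * swap a b).SameCycle a ((w ^ (j + 1)) b) := by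
    intro j
    induction j with
    | zero => simpa using sameCycle_apply_self (w * swap a b) a
    | succ j ih =>
      rw [pow_succ', Perm.mul_apply]
      set y := (w ^ (j + 1)) b with hy
      have hby : w.SameCycle b y := ⟨(j + 1 : ℕ), by rw [zpow_natCast]⟩
      by_cases h1 : y = b
      · rw [h1]
        simpa using sameCycle_apply_self (w * swap a b) a
      · have h2 : y ≠ a := by
          rintro rfl
          exact h hby.symm
        have := sameCycle_apply_self (w * swap a b) y
        rw [Perm.mul_apply, swap_apply_of_ne_of_ne h2 h1] at this
        exact ih.trans this
  have := key (orderOf w - 1)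
  rwa [Nat.sub_add_cancel (orderOf_pos w), pow_orderOf_eq_one] at this

theorem SameCycle.mul_swap {w : Perm (Fin n)} {a b : Fin n} (h : ¬ w.SameCycle a b)
    {x y : Fin n} (hxy : w.SameCycle x y) : (w * swap a b).SameCycle x y := by
  have hab := sameCycle_mul_swap h
  refine sameCycle_rec (fun x => SameCycle.refl _ x) (fun _ _ _ => SameCycle.trans) (fun x => ?_) hxy
  rcases eq_or_ne x a with rfl | hxa
  · simpa using hab.trans (sameCycle_apply_self (w * swap x b) b)
  rcases eq_or_ne x b with rfl | hxb
  · simpa using hab.symm.trans (sameCycle_apply_self (w * swap a x) a)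
  · simpa [swap_apply_of_ne_of_ne hxa hxb] using sameCycle_apply_self (w * swap a b) x

/-! ### Reflection length as the codimension of the space of fixed functions -/

/-- The functions that are constant on the cycles of a permutation. -/
def fixedFunctions (w : Perm (Fin n)) : Submodule ℚ (Fin n → ℚ) where
  carrier := {f | ∀ x, f (w x) = f x}
  add_mem' hf hg x := by simp [hf x, hg x]
  zero_mem' _ := rfl
  smul_mem' c f hf x := by simp [hf x]

theorem mem_fixedFunctions {w : Perm (Fin n)} {f : Fin n → ℚ} :
    f ∈ fixedFunctions w ↔ ∀ x, f (w x) = f x := Iff.rfl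

theorem eq_of_mem_fixedFunctions {w : Perm (Fin n)} {f : Fin n → ℚ} (hf : f ∈ fixedFunctions w)
    {x y : Fin n} (h : w.SameCycle x y) : f x = f y :=
  sameCycle_rec (r := fun x y => f x = f y) (fun _ => rfl) (fun _ _ _ => Eq.trans)
    (fun x => (hf x).symm) h

theorem fixedFunctions_one : fixedFunctions (1 : Perm (Fin n)) = ⊤ := by
  ext f
  simp [mem_fixedFunctions]

theorem finrank_fixedFunctions_one : Module.finrank ℚ (fixedFunctions (1 : Perm (Fin n))) = n := by
  rw [fixedFunctions_one, finrank_top]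
  simp

/-- The single linear condition `f a = f b` costs at most one dimension, and a function fixed by `w`
that satisfies it is also fixed by the product. -/
theorem finrank_fixedFunctions_le_succ (w : Perm (Fin n)) (a b : Fin n) :
    Module.finrank ℚ (fixedFunctions w) ≤ Module.finrank ℚ (fixedFunctions (w * swap a b)) + 1 := by
  let φ : (Fin n → ℚ) →ₗ[ℚ] ℚ := LinearMap.proj (R := ℚ) (φ := fun _ => ℚ) a - LinearMap.proj b
  have hle : fixedFunctions w ⊓ LinearMap.ker φ ≤ fixedFunctions (w * swap a b) := by
    rintro f ⟨hf, hφ⟩ x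
    have hab : f a = f b := by simpa [φ, sub_eq_zero] using hφ
    rw [Perm.mul_apply, hf]
    rcases eq_or_ne x a with rfl | hxa
    · simp [hab]
    rcases eq_or_ne x b with rfl | hxb
    · simp [hab]
    · rw [swap_apply_of_ne_of_ne hxa hxb]
  have h1 := Submodule.finrank_mono hle
  have h2 := Submodule.finrank_sup_add_finrank_inf_eq (fixedFunctions w) (LinearMap.ker φ)
  have h3 := LinearMap.finrank_range_add_finrank_ker φ
  have h4 : Module.finrank ℚ (LinearMap.range φ) ≤ 1 := by
    simpa using Submodule.finrank_le (LinearMap.range φ)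
  have h5 := Submodule.finrank_le (fixedFunctions w ⊔ LinearMap.ker φ)
  omega

theorem finrank_fixedFunctions_lt {w : Perm (Fin n)} {a b : Fin n} (h : ¬ w.SameCycle a b) :
    Module.finrank ℚ (fixedFunctions (w * swap a b)) < Module.finrank ℚ (fixedFunctions w) := by
  classical
  apply Submodule.finrank_lt_finrank_of_lt
  refine lt_of_le_of_ne (fun f hf x => ?_) (fun heq => ?_)
  · exact (eq_of_mem_fixedFunctions hf (SameCycle.mul_swap h (sameCycle_apply_self w x))).symm
  -- Strictness: the indicator of the cycle of `a` is constant on the cycles of `w`, but not on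
  -- those of the product, which join `a` to `b`.
  · have hf : (fun x => if w.SameCycle a x then (1 : ℚ) else 0) ∈ fixedFunctions w := by
      intro x
      simp only [sameCycle_apply_right]
    rw [← heq] at hf
    have := eq_of_mem_fixedFunctions hf (sameCycle_mul_swap h)
    simp [h, SameCycle.refl] at this

theorem le_length_add_finrank (L : List (Perm (Fin n))) (hL : ∀ r ∈ L, r.IsSwap) :
    n ≤ L.length + Module.finrank ℚ (fixedFunctions L.prod) := by
  induction L using List.reverseRecOn with
  | nil => exact finrank_fixedFunctions_one.symm.le.trans (Nat.le_add_left _ _)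
  | append_singleton L t ih =>
    obtain ⟨a, b, -, rfl⟩ := hL t (by simp)
    have h1 := ih (fun r hr => hL r (by simp [hr]))
    have h2 := finrank_fixedFunctions_le_succ L.prod a b
    rw [List.prod_append, List.prod_singleton, List.length_append, List.length_singleton]
    omega

theorem exists_swaps (m : ℕ) : ∀ w : Perm (Fin n), n ≤ m + Module.finrank ℚ (fixedFunctions w) →
    ∃ L : List (Perm (Fin n)), (∀ r ∈ L, r.IsSwap) ∧ L.prod = w ∧ L.length ≤ m := by
  induction m with
  | zero =>
    intro w hw
    refine ⟨[], by simp, ?_, by simp⟩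
    have htop : fixedFunctions w = ⊤ := by
      apply Submodule.eq_top_of_finrank_eq
      have := Submodule.finrank_le (fixedFunctions w)
      simp only [Module.finrank_fin_fun] at this ⊢
      omega
    ext x : 1
    have h : Pi.single x (1 : ℚ) ∈ fixedFunctions w := htop ▸ Submodule.mem_top
    have := h x
    by_contra hne
    simp only [Pi.single_apply, if_true, ite_eq_left_iff, zero_ne_one, imp_false, not_not] at this
    exact hne (by simpa using this.symm)
  | succ m ih =>
    intro w hw
    by_cases hw1 : w = 1
    · exact ⟨[], by simp, by simp [hw1], by simp⟩
    obtain ⟨a, ha⟩ : ∃ a, w a ≠ a := by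
      by_contra! h
      exact hw1 (Equiv.ext h)
    -- This choice makes `a` a fixed point of `u`, so `w` arises from `u` by merging two cycles, and
    -- `u` has more fixed functions than `w`.
    set u := w * swap (w⁻¹ a) a with hu
    have huu : u a = a := by simp [hu]
    have hns : ¬ u.SameCycle (w⁻¹ a) a := by
      intro hs
      have h1 := hs.symm.eq_of_left huu
      exact ha (Perm.inv_eq_iff_eq.1 h1.symm).symm
    have hlt := finrank_fixedFunctions_lt hns
    have huw : u * swap (w⁻¹ a) a = w := by simp [hu, mul_assoc]
    rw [huw] at hlt
    obtain ⟨L, hL, hprod, hlen⟩ := ih u (by omega)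
    refine ⟨L ++ [swap (w⁻¹ a) a], ?_, by rw [List.prod_append, hprod, List.prod_singleton, huw], by simpa using hlen⟩
    intro r hr
    rcases List.mem_append.1 hr with hr | hr
    · exact hL r hr
    · rw [List.mem_singleton.1 hr]
      exact ⟨_, _, fun h => ha (Perm.inv_eq_iff_eq.1 h).symm, rfl⟩

theorem exists_swaps_length_eq (w : Perm (Fin n)) :
    ∃ L : List (Perm (Fin n)), (∀ r ∈ L, r.IsSwap) ∧ L.prod = w ∧
      L.length = reflectionLength w := by
  obtain ⟨L, hL, hw, -⟩ := exists_swaps n w (by omega)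
  exact Nat.sInf_mem (s := {m : ℕ | ∃ L : List (Perm (Fin n)),
    (∀ r ∈ L, r.IsSwap) ∧ L.prod = w ∧ L.length = m}) ⟨_, L, hL, hw, rfl⟩

theorem reflectionLength_le {w : Perm (Fin n)} {L : List (Perm (Fin n))}
    (hL : ∀ r ∈ L, r.IsSwap) (hw : L.prod = w) : reflectionLength w ≤ L.length :=
  Nat.sInf_le ⟨L, hL, hw, rfl⟩

theorem reflectionLength_add_finrank (w : Perm (Fin n)) :
    reflectionLength w + Module.finrank ℚ (fixedFunctions w) = n := by
  apply le_antisymm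
  · have hle := Submodule.finrank_le (fixedFunctions w)
    simp only [Module.finrank_fin_fun] at hle
    obtain ⟨L, hL, hw, hlen⟩ :=
      exists_swaps (n - Module.finrank ℚ (fixedFunctions w)) w (by omega)
    have := reflectionLength_le hL hw
    omega
  · obtain ⟨L, hL, hw, hlen⟩ := exists_swaps_length_eq w
    have := le_length_add_finrank L hL
    rwa [hw, hlen] at this

theorem reflectionLength_lt_mul_swap {w : Perm (Fin n)} {a b : Fin n} (h : ¬ w.SameCycle a b) :
    reflectionLength w < reflectionLength (w * swap a b) := by
  have h1 := finrank_fixedFunctions_lt h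
  have h2 := reflectionLength_add_finrank w
  have h3 := reflectionLength_add_finrank (w * swap a b)
  omega

/-! ### Cyclic order and noncrossing permutations -/

/-- `b` lies strictly between `a` and `c` in the cyclic order. -/
def Cyc (a b c : Fin n) : Prop := a < b ∧ b < c ∨ b < c ∧ c < a ∨ c < a ∧ a < b

/-- The cyclic intervals between `x` and `y`, each closed at its right end, do not separate `a`
from `b`. -/
def Uncrossed (x y a b : Fin n) : Prop := (x < a ↔ y < a) ↔ (x < b ↔ y < b)

theorem Uncrossed.refl_left (x a b : Fin n) : Uncrossed x x a b := by simp [Uncrossed]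

theorem Uncrossed.refl_right (x y a : Fin n) : Uncrossed x y a a := Iff.rfl

theorem Uncrossed.trans_left {x y z a b : Fin n} (h : Uncrossed x y a b) (h' : Uncrossed y z a b) :
    Uncrossed x z a b := by
  unfold Uncrossed at *; tauto

theorem Uncrossed.trans_right {x y a b c : Fin n} (h : Uncrossed x y a b)
    (h' : Uncrossed x y b c) : Uncrossed x y a c :=
  Iff.trans h h'

theorem Uncrossed.swap_left {x y a b : Fin n} (h : Uncrossed x y a b) : Uncrossed y x a b := by
  unfold Uncrossed at *; tauto

theorem not_uncrossed_self {x y : Fin n} (h : x ≠ y) : ¬ Uncrossed x y x y := by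
  rcases lt_or_gt_of_ne h with h | h <;> simp [Uncrossed, h, h.not_gt]

/-- A permutation each of whose cycles lists its elements in cyclic order, and whose cycles are
pairwise noncrossing: no cycle separates `v` from `w v`. -/
def IsNoncrossingCyclic (w : Perm (Fin n)) : Prop :=
  ∀ v x, Cyc v x (w v) → Cyc v (w x) (w v)

theorem IsNoncrossingCyclic.cyc_of_sameCycle {w : Perm (Fin n)} (hw : IsNoncrossingCyclic w)
    {v x y : Fin n} (h : w.SameCycle x y) : Cyc v x (w v) → Cyc v y (w v) :=
  sameCycle_rec (r := fun x y => Cyc v x (w v) → Cyc v y (w v)) (fun _ h => h)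
    (fun _ _ _ h h' hx => h' (h hx)) (fun x => hw v x) h

/-- The open arc from `v` to `w v` is stable under `w`; if it contained an element of the cycle of
`v`, it would contain its own end `v`. Thus `w v` is the next element of the cycle after `v`. -/
theorem IsNoncrossingCyclic.not_cyc {w : Perm (Fin n)} (hw : IsNoncrossingCyclic w)
    {v x : Fin n} (h : w.SameCycle v x) : ¬ Cyc v x (w v) := by
  intro h'
  have := hw.cyc_of_sameCycle h.symm h'
  simp only [Cyc, Fin.lt_def] at this
  omega

theorem isNoncrossingCyclic_one : IsNoncrossingCyclic (1 : Perm (Fin n)) := by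
  intro v x h
  exact h

/-- After the merge `a` is sent to `w b`; this treats the one new arc starting at `a`. The arc
starting at `b` follows by exchanging `a` and `b`. -/
theorem IsNoncrossingCyclic.merge_aux {w : Perm (Fin n)} (hw : IsNoncrossingCyclic w)
    {a b : Fin n} (hab : a ≠ b) (h : ∀ x, Uncrossed a b x (w x)) (x : Fin n)
    (hx : Cyc a x (w b)) : Cyc a ((w * swap a b) x) (w b) := by
  have hinj : ∀ y z, y ≠ z → w y ≠ w z := fun y z h1 h2 => h1 (w.injective h2)
  have h2 := hw b x
  have h3 := h x
  have h4 := h a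
  have h5 := h b
  have h6 := hinj x b
  have h7 := hinj a b hab
  by_cases hxb : x = b
  · subst hxb
    clear h2 h3 h6
    rw [Perm.mul_apply, swap_apply_right]
    simp only [Cyc, Uncrossed, Fin.lt_def, ne_eq, Fin.ext_iff] at *; omega
  by_cases hxa : x = a
  · simp only [Cyc, Fin.lt_def, Fin.ext_iff] at *; omega
  rw [Perm.mul_apply, swap_apply_of_ne_of_ne hxa hxb]
  clear h4 h7
  simp only [Cyc, Uncrossed, Fin.lt_def, ne_eq, Fin.ext_iff] at *; omega

/-- Merging two cycles of a noncrossing permutation by a transposition that crosses neither. -/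
theorem IsNoncrossingCyclic.merge {w : Perm (Fin n)} (hw : IsNoncrossingCyclic w) {a b : Fin n}
    (hab : a ≠ b) (h : ∀ x, Uncrossed a b x (w x)) : IsNoncrossingCyclic (w * swap a b) := by
  intro v x hx
  by_cases hva : v = a
  · subst hva
    rw [Perm.mul_apply _ _ v, swap_apply_left] at hx ⊢
    exact hw.merge_aux hab h x hx
  by_cases hvb : v = b
  · subst hvb
    rw [Perm.mul_apply _ _ v, swap_apply_right] at hx ⊢
    rw [swap_comm]
    exact hw.merge_aux hab.symm (fun x => (h x).swap_left) x hx
  rw [Perm.mul_apply _ _ v, swap_apply_of_ne_of_ne hva hvb] at hx ⊢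
  have h1 := hw v a
  have h2 := hw v b
  have h3 := h v
  -- An old arc contains both or neither of `a` and `b`, so exchanging them before applying `w` does
  -- not lead out of it.
  have h4 : Cyc v a (w v) ↔ Cyc v b (w v) := by
    clear h1 h2 hx
    simp only [Cyc, Uncrossed, Fin.lt_def, Fin.ext_iff] at *; omega
  rcases eq_or_ne x a with rfl | hxa
  · rw [Perm.mul_apply, swap_apply_left]
    exact h2 (h4.1 hx)
  rcases eq_or_ne x b with rfl | hxb
  · rw [Perm.mul_apply, swap_apply_right]
    exact h1 (h4.2 hx)
  rw [Perm.mul_apply, swap_apply_of_ne_of_ne hxa hxb]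
  exact hw v x hx

theorem SameCycle.apply_ne {w : Perm (Fin n)} {a b : Fin n} (hab : a ≠ b) (h : w.SameCycle a b) :
    w a ≠ a :=
  fun ha => hab (h.eq_of_left ha)

theorem IsNoncrossingCyclic.split_aux {w : Perm (Fin n)} (hw : IsNoncrossingCyclic w)
    {a b : Fin n} (hab : a ≠ b) (h : w.SameCycle a b) (x : Fin n)
    (hx : Cyc a x (w b)) : Cyc a ((w * swap a b) x) (w b) := by
  have hinj : ∀ y z, y ≠ z → w y ≠ w z := fun y z h1 h2 => h1 (w.injective h2)
  by_cases hxb : x = b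
  · have h2 := hw.not_cyc h
    have h3 := SameCycle.apply_ne hab h
    have h7 := hinj a b hab
    clear hw hinj h
    subst hxb
    rw [Perm.mul_apply, swap_apply_right]
    simp only [Cyc, Fin.lt_def, ne_eq, Fin.ext_iff] at *; omega
  by_cases hxa : x = a
  · simp only [Cyc, Fin.lt_def, Fin.ext_iff] at *; omega
  have h1 := hw.not_cyc (h.symm)
  have h6 := hinj x b hxb
  have h4 : Cyc x b (w x) → Cyc x a (w x) := hw.cyc_of_sameCycle h.symm
  have h3 := hw b x
  rw [Perm.mul_apply, swap_apply_of_ne_of_ne hxa hxb]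
  clear hw hinj h
  by_cases hc : Cyc b x (w b)
  · have h5 := h3 hc
    clear h3 h4 hc
    simp only [Cyc, Fin.lt_def, ne_eq, Fin.ext_iff] at *; omega
  · clear h3
    simp only [Cyc, Fin.lt_def, ne_eq, Fin.ext_iff] at *; omega

/-- Splitting a cycle of a noncrossing permutation by a transposition. -/
theorem IsNoncrossingCyclic.split {w : Perm (Fin n)} (hw : IsNoncrossingCyclic w) {a b : Fin n}
    (hab : a ≠ b) (h : w.SameCycle a b) : IsNoncrossingCyclic (w * swap a b) := by
  intro v x hx
  by_cases hva : v = a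
  · subst hva
    rw [Perm.mul_apply _ _ v, swap_apply_left] at hx ⊢
    exact hw.split_aux hab h x hx
  by_cases hvb : v = b
  · subst hvb
    rw [Perm.mul_apply _ _ v, swap_apply_right] at hx ⊢
    rw [swap_comm]
    exact hw.split_aux hab.symm h.symm x hx
  rw [Perm.mul_apply _ _ v, swap_apply_of_ne_of_ne hva hvb] at hx ⊢
  rcases eq_or_ne x a with rfl | hxa
  · rw [Perm.mul_apply, swap_apply_left]
    exact hw v b (hw.cyc_of_sameCycle h hx)
  rcases eq_or_ne x b with rfl | hxb
  · rw [Perm.mul_apply, swap_apply_right]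
    exact hw v a (hw.cyc_of_sameCycle h.symm hx)
  rw [Perm.mul_apply, swap_apply_of_ne_of_ne hxa hxb]
  exact hw v x hx

/-- The arc from `x` to `w x` is stable under `w`, so it contains both or neither of `a` and `b`.
The case `x = a ≠ b` has to be excluded: then `w a` lies in `(a, b]` and `a` does not. -/
theorem IsNoncrossingCyclic.uncrossed_of_ne {w : Perm (Fin n)} (hw : IsNoncrossingCyclic w)
    {a b x : Fin n} (h : w.SameCycle a b) (hxa : x ≠ a) (hxb : x ≠ b) :
    Uncrossed a b x (w x) := by
  have h4 : Cyc x a (w x) ↔ Cyc x b (w x) :=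
    ⟨hw.cyc_of_sameCycle h, hw.cyc_of_sameCycle h.symm⟩
  simp only [Cyc, Uncrossed, Fin.lt_def, ne_eq, Fin.ext_iff] at *; omega

/-- The successor of `b` in its cycle is met no later than `a`, so `w b` and `a` both lie in `(b,
a]`. -/
theorem IsNoncrossingCyclic.uncrossed_split_aux {w : Perm (Fin n)} (hw : IsNoncrossingCyclic w)
    {a b : Fin n} (hab : a ≠ b) (h : w.SameCycle a b) : Uncrossed a b a (w b) := by
  have h1 := hw.not_cyc h.symm
  have h2 := SameCycle.apply_ne hab.symm h.symm
  simp only [Cyc, Uncrossed, Fin.lt_def, ne_eq, Fin.ext_iff] at *; omega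

theorem IsNoncrossingCyclic.uncrossed_split {w : Perm (Fin n)} (hw : IsNoncrossingCyclic w)
    {a b : Fin n} (hab : a ≠ b) (h : w.SameCycle a b) {x y : Fin n}
    (hxy : (w * swap a b).SameCycle x y) : Uncrossed a b x y := by
  refine sameCycle_rec (Uncrossed.refl_right a b) (fun _ _ _ => Uncrossed.trans_right)
    (fun x => ?_) hxy
  rcases eq_or_ne x a with rfl | hxa
  · rw [Perm.mul_apply, swap_apply_left]
    exact hw.uncrossed_split_aux hab h
  rcases eq_or_ne x b with rfl | hxb
  · rw [Perm.mul_apply, swap_apply_right]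
    exact (hw.uncrossed_split_aux hab.symm h.symm).swap_left
  rw [Perm.mul_apply, swap_apply_of_ne_of_ne hxa hxb]
  exact hw.uncrossed_of_ne h hxa hxb

/-- Two different cycles of a noncrossing permutation do not cross. -/
theorem IsNoncrossingCyclic.uncrossed {w : Perm (Fin n)} (hw : IsNoncrossingCyclic w)
    {a b x y : Fin n} (hab : w.SameCycle a b) (hxy : w.SameCycle x y) (hax : ¬ w.SameCycle a x) :
    Uncrossed a b x y := by
  have key : w.SameCycle x y ∧ Uncrossed a b x y := by
    refine sameCycle_rec (r := fun u v => w.SameCycle x u → w.SameCycle x v ∧ Uncrossed a b u v)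
      (fun u hu => ⟨hu, Uncrossed.refl_right a b u⟩)
      (fun u v z h1 h2 hu => ⟨(h2 (h1 hu).1).1, (h1 hu).2.trans_right (h2 (h1 hu).1).2⟩)
      (fun u hu => ⟨hu.trans (sameCycle_apply_self w u), hw.uncrossed_of_ne hab ?_ ?_⟩) hxy
      (SameCycle.refl _ _)
    · rintro rfl
      exact hax hu.symm
    · rintro rfl
      exact hax (hab.trans hu.symm)
  exact key.2

/-- A noncrossing permutation is determined by its cycles as sets. -/
theorem IsNoncrossingCyclic.eq_of_sameCycle_iff {w w' : Perm (Fin n)} (hw : IsNoncrossingCyclic w)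
    (hw' : IsNoncrossingCyclic w') (h : ∀ x y, w.SameCycle x y ↔ w'.SameCycle x y) : w = w' := by
  ext1 v
  -- Neither `w v` nor `w' v` lies strictly before the other on the way round from `v`.
  have h1 := hw.not_cyc ((h _ _).2 (sameCycle_apply_self w' v))
  have h2 := hw'.not_cyc ((h _ _).1 (sameCycle_apply_self w v))
  have h3 : w v = v ↔ w' v = v := by
    constructor
    · intro hv
      exact (((h _ _).2 (sameCycle_apply_self w' v)).eq_of_left hv).symm
    · intro hv
      exact (((h _ _).1 (sameCycle_apply_self w v)).eq_of_left hv).symm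
  simp only [Cyc, Fin.lt_def, Fin.ext_iff] at *; omega

/-! ### Shortest factorizations into transpositions -/

/-- The product, from left to right, of the transpositions of a list of pairs. -/
def swapProd (T : List (Fin n × Fin n)) : Perm (Fin n) :=
  leftToRightProd (T.map fun q => swap q.1 q.2)

theorem swapProd_cons (q : Fin n × Fin n) (T : List (Fin n × Fin n)) :
    swapProd (q :: T) = swapProd T * swap q.1 q.2 := by
  simp [swapProd, leftToRightProd]

theorem reflectionLength_swapProd_le {T : List (Fin n × Fin n)} (hT : ∀ q ∈ T, q.1 ≠ q.2) :
    reflectionLength (swapProd T) ≤ T.length := by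
  refine (reflectionLength_le (L := (T.map fun q => swap q.1 q.2).reverse) ?_ rfl).trans_eq
    (by rw [List.length_reverse, List.length_map])
  intro r hr
  obtain ⟨q, hq, rfl⟩ := List.mem_map.1 (List.mem_reverse.1 hr)
  exact ⟨q.1, q.2, hT q hq, rfl⟩

theorem exists_swapProd_eq (w : Perm (Fin n)) :
    ∃ T : List (Fin n × Fin n), (∀ q ∈ T, q.1 ≠ q.2) ∧ swapProd T = w ∧
      T.length = reflectionLength w := by
  have key : ∀ L : List (Perm (Fin n)), (∀ r ∈ L, r.IsSwap) → ∃ T : List (Fin n × Fin n),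
      (∀ q ∈ T, q.1 ≠ q.2) ∧ (T.map fun q => swap q.1 q.2) = L := by
    intro L hL
    induction L with
    | nil => exact ⟨[], by simp, rfl⟩
    | cons t L ih =>
      obtain ⟨T, hT, h⟩ := ih fun r hr => hL r (by simp [hr])
      obtain ⟨a, b, hab, rfl⟩ := hL t (by simp)
      refine ⟨(a, b) :: T, ?_, by simp [h]⟩
      intro q hq
      rcases List.mem_cons.1 hq with rfl | hq
      · exact hab
      · exact hT q hq
  obtain ⟨L, hL, hprod, hlen⟩ := exists_swaps_length_eq w
  obtain ⟨T, hT, h⟩ := key L.reverse (by simpa using hL)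
  refine ⟨T, hT, by rw [swapProd, h, leftToRightProd, List.reverse_reverse, hprod], ?_⟩
  rw [← hlen, ← List.length_reverse (as := L), ← h, List.length_map]

theorem swapProd_append (S T : List (Fin n × Fin n)) :
    swapProd (S ++ T) = swapProd T * swapProd S := by
  simp only [swapProd, List.map_append, leftToRightProd_append]

theorem reflectionLength_mul_le (u w : Perm (Fin n)) :
    reflectionLength (u * w) ≤ reflectionLength u + reflectionLength w := by
  obtain ⟨S, hS, rfl, hS'⟩ := exists_swapProd_eq u
  obtain ⟨T, hT, rfl, hT'⟩ := exists_swapProd_eq w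
  rw [← swapProd_append, ← hS', ← hT', add_comm, ← List.length_append]
  refine reflectionLength_swapProd_le fun q hq => ?_
  rcases List.mem_append.1 hq with hq | hq
  · exact hT q hq
  · exact hS q hq

theorem reflectionLength_one : reflectionLength (1 : Perm (Fin n)) = 0 :=
  Nat.le_zero.1 (reflectionLength_le (L := []) (by simp) rfl)

theorem reflectionLength_leftToRightProd_le (L : List (Perm (Fin n))) :
    reflectionLength (leftToRightProd L) ≤ (L.map reflectionLength).sum := by
  induction L with
  | nil => simp [leftToRightProd, reflectionLength_one]
  | cons s L ih =>
    rw [leftToRightProd_cons, List.map_cons, List.sum_cons]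
    have := reflectionLength_mul_le (leftToRightProd L) s
    omega

/-- The cycles of a product of transpositions are contained in the classes of every equivalence
relation that contains the transposed pairs. -/
theorem rel_of_sameCycle_swapProd {r : Fin n → Fin n → Prop} (hr : Equivalence r)
    {T : List (Fin n × Fin n)} (hT : ∀ q ∈ T, r q.1 q.2) {x y : Fin n}
    (h : (swapProd T).SameCycle x y) : r x y := by
  refine sameCycle_rec hr.refl (fun _ _ _ => hr.trans) (fun x => ?_) h
  clear h
  induction T generalizing x with
  | nil => simpa [swapProd, leftToRightProd] using hr.refl x
  | cons q T ih =>
    have ih := ih fun q' hq' => hT q' (by simp [hq'])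
    have hq := hT q (by simp)
    rw [swapProd_cons, Perm.mul_apply]
    refine hr.trans ?_ (ih _)
    by_cases hx1 : x = q.1
    · rw [hx1, swap_apply_left]
      exact hq
    by_cases hx2 : x = q.2
    · rw [hx2, swap_apply_right]
      exact hr.symm hq
    · rw [swap_apply_of_ne_of_ne hx1 hx2]
      exact hr.refl x

theorem uncrossed_equivalence_right (a b : Fin n) : Equivalence (Uncrossed a b) :=
  ⟨Uncrossed.refl_right a b, Iff.symm, Iff.trans⟩

theorem uncrossed_equivalence_left (a b : Fin n) : Equivalence (Uncrossed · · a b) :=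
  ⟨fun _ => Uncrossed.refl_left _ a b, Uncrossed.swap_left, Uncrossed.trans_left⟩

/-- A list of transpositions each of which is uncrossed with the later ones. -/
abbrev UncrossedList (T : List (Fin n × Fin n)) : Prop :=
  T.Pairwise fun q r => Uncrossed q.1 q.2 r.1 r.2

/-- The cycles of the product of the tail lie in classes of the equivalence relation `Uncrossed q.1
q.2`, which separates `q.1` from `q.2`. So `q` joins two cycles without crossing any, and the
reflection length grows at every step. -/
theorem UncrossedList.swapProd_spec {T : List (Fin n × Fin n)} (hT : UncrossedList T)
    (hne : ∀ q ∈ T, q.1 ≠ q.2) :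
    IsNoncrossingCyclic (swapProd T) ∧ (∀ q ∈ T, (swapProd T).SameCycle q.1 q.2) ∧
      T.length ≤ reflectionLength (swapProd T) := by
  induction T with
  | nil => exact ⟨isNoncrossingCyclic_one, by simp, by simp⟩
  | cons q T ih =>
    rw [UncrossedList, List.pairwise_cons] at hT
    obtain ⟨h1, h2, h3⟩ := ih hT.2 fun q' hq' => hne q' (by simp [hq'])
    have hq := hne q (by simp)
    have hun : ∀ x y, (swapProd T).SameCycle x y → Uncrossed q.1 q.2 x y := fun x y h =>
      rel_of_sameCycle_swapProd (uncrossed_equivalence_right q.1 q.2) hT.1 h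
    have hns : ¬ (swapProd T).SameCycle q.1 q.2 := fun h => not_uncrossed_self hq (hun _ _ h)
    rw [swapProd_cons]
    refine ⟨h1.merge hq fun x => hun _ _ (sameCycle_apply_self _ x), ?_, ?_⟩
    · intro q' hq'
      rcases List.mem_cons.1 hq' with rfl | hq'
      · exact sameCycle_mul_swap hns
      · exact SameCycle.mul_swap hns (h2 q' hq')
    · have := reflectionLength_lt_mul_swap hns
      rw [List.length_cons]
      omega

/-- A shortest factorization of a noncrossing permutation into transpositions is uncrossed. -/
theorem uncrossedList_of_length_eq {T : List (Fin n × Fin n)} (hne : ∀ q ∈ T, q.1 ≠ q.2)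
    (hw : IsNoncrossingCyclic (swapProd T)) (hlen : T.length ≤ reflectionLength (swapProd T)) :
    UncrossedList T := by
  induction T with
  | nil => exact List.Pairwise.nil
  | cons q T ih =>
    have hne' : ∀ q' ∈ T, q'.1 ≠ q'.2 := fun q' hq' => hne q' (by simp [hq'])
    have hq := hne q (by simp)
    have hT := reflectionLength_swapProd_le hne'
    rw [swapProd_cons, List.length_cons] at hlen
    rw [swapProd_cons] at hw
    have hmul : swapProd T * swap q.1 q.2 * swap q.1 q.2 = swapProd T := by simp [mul_assoc]
    -- If `q` did not split a cycle, removing it would raise the reflection length above the number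
    -- of remaining transpositions.
    have hs : (swapProd T * swap q.1 q.2).SameCycle q.1 q.2 := by
      by_contra hns
      have := reflectionLength_lt_mul_swap hns
      rw [hmul] at this
      omega
    have hle := reflectionLength_mul_le (swapProd T) (swap q.1 q.2)
    have hsw : reflectionLength (swap q.1 q.2) ≤ 1 :=
      reflectionLength_le (L := [swap q.1 q.2]) (by simpa using ⟨q.1, q.2, hq, rfl⟩) (by simp)
    have hw' := hw.split hq hs
    have hun := fun x y => hw.uncrossed_split hq hs (x := x) (y := y)
    rw [hmul] at hw'
    simp only [hmul] at hun
    have hTu := ih hne' hw' (by omega)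
    -- By the converse result each later pair lies in one cycle of the product of the tail, and no
    -- such cycle is separated by `q`.
    exact List.pairwise_cons.2
      ⟨fun q' hq' => hun _ _ ((hTu.swapProd_spec hne').2.1 q' hq'), hTu⟩

/-! ### Lists of hyperedges -/

/-- `f` may precede `e` in a properly ordered noncrossing hyperforest. -/
def Precedes (f e : Finset (Fin n)) : Prop :=
  ∀ x ∈ f, ∀ y ∈ f, ∀ a ∈ e, ∀ b ∈ e, Uncrossed x y a b

/-- The pairs of consecutive elements of a hyperedge, from right to left. -/
def edgeSwaps (e : Finset (Fin n)) : List (Fin n × Fin n) :=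
  ((e.sort (· ≤ ·)).zip (e.sort (· ≤ ·)).tail).reverse

theorem swapProd_edgeSwaps (e : Finset (Fin n)) : swapProd (edgeSwaps e) = edgePerm e := by
  rw [swapProd, edgeSwaps, leftToRightProd, List.map_reverse, List.reverse_reverse, edgePerm,
    List.formPerm, List.zip, List.map_zipWith]

theorem mem_zip_tail {α : Type*} {l : List α} {q : α × α} (h : q ∈ l.zip l.tail) :
    q.1 ∈ l ∧ q.2 ∈ l :=
  ⟨(List.of_mem_zip h).1, List.mem_of_mem_tail (List.of_mem_zip h).2⟩

theorem mem_of_mem_edgeSwaps {e : Finset (Fin n)} {q : Fin n × Fin n} (h : q ∈ edgeSwaps e) :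
    q.1 ∈ e ∧ q.2 ∈ e := by
  simpa using mem_zip_tail (List.mem_reverse.1 h)

/-- The direction matters: adjacent pairs share a vertex, and with half-open intervals only the
right pair is uncrossed with the left one. This is why `edgeSwaps` runs from right to left. -/
theorem pairwise_zip_tail {l : List (Fin n)} (hl : l.Pairwise (· < ·)) :
    (l.zip l.tail).Pairwise (fun q r => Uncrossed r.1 r.2 q.1 q.2) ∧
      ∀ q ∈ l.zip l.tail, q.1 ≠ q.2 := by
  induction l with
  | nil => simp
  | cons a l ih =>
    cases l with
    | nil => simp
    | cons b l =>
      rw [List.pairwise_cons] at hl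
      obtain ⟨h1, h2⟩ := ih hl.2
      have hab := hl.1 b (by simp)
      simp only [List.tail_cons, List.zip_cons_cons] at h1 h2 ⊢
      have hb : ∀ x ∈ b :: l, b ≤ x := by
        intro x hx
        rcases List.mem_cons.1 hx with rfl | hx
        · exact le_rfl
        · exact ((List.pairwise_cons.1 hl.2).1 x hx).le
      refine ⟨List.pairwise_cons.2 ⟨fun q hq => ?_, h1⟩, fun q hq => ?_⟩
      · have hq' := mem_zip_tail (l := b :: l) hq
        have h3 := hb _ hq'.1
        have h4 := hb _ hq'.2
        simp [Uncrossed, h3.not_gt, h4.not_gt, (hab.trans_le h3).not_gt, (hab.trans_le h4).not_gt]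
      · rcases List.mem_cons.1 hq with rfl | hq
        · exact hab.ne
        · exact h2 q hq

theorem rel_of_zip_tail {α : Type*} {r : α → α → Prop} (hr : Equivalence r) {l : List α}
    (h : ∀ q ∈ l.zip l.tail, r q.1 q.2) : ∀ x ∈ l, ∀ y ∈ l, r x y := by
  induction l with
  | nil => simp
  | cons a l ih =>
    cases l with
    | nil => simpa using hr.refl a
    | cons b l =>
      simp only [List.tail_cons, List.zip_cons_cons, List.mem_cons, forall_eq_or_imp] at h
      have ih := ih h.2
      have ha : ∀ x ∈ b :: l, r a x := fun x hx => hr.trans h.1 (ih b (by simp) x hx)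
      intro x hx y hy
      rcases List.mem_cons.1 hx with rfl | hx' <;> rcases List.mem_cons.1 hy with rfl | hy'
      · exact hr.refl _
      · exact ha y hy'
      · exact hr.symm (ha x hx')
      · exact ih x hx' y hy'

theorem edgeSwaps_ne {e : Finset (Fin n)} {q : Fin n × Fin n} (hq : q ∈ edgeSwaps e) :
    q.1 ≠ q.2 :=
  (pairwise_zip_tail e.sortedLT_sort.pairwise).2 q (List.mem_reverse.1 hq)

theorem uncrossedList_edgeSwaps (e : Finset (Fin n)) : UncrossedList (edgeSwaps e) :=
  List.pairwise_reverse.2 (pairwise_zip_tail e.sortedLT_sort.pairwise).1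

theorem rel_of_edgeSwaps {r : Fin n → Fin n → Prop} (hr : Equivalence r) {e : Finset (Fin n)}
    (h : ∀ q ∈ edgeSwaps e, r q.1 q.2) : ∀ x ∈ e, ∀ y ∈ e, r x y := by
  simpa using rel_of_zip_tail hr (l := e.sort (· ≤ ·)) fun q hq => h q (List.mem_reverse.2 hq)

theorem swapProd_flatMap (E : List (Finset (Fin n))) :
    swapProd (E.flatMap edgeSwaps) = leftToRightProd (E.map edgePerm) := by
  induction E with
  | nil => rfl
  | cons e E ih =>
    rw [List.flatMap_cons, swapProd_append, ih, swapProd_edgeSwaps, List.map_cons,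
      leftToRightProd_cons]

theorem uncrossedList_flatMap {E : List (Finset (Fin n))} (hE : E.Pairwise Precedes) :
    UncrossedList (E.flatMap edgeSwaps) := by
  refine List.pairwise_flatMap.2 ⟨fun e _ => uncrossedList_edgeSwaps e, hE.imp ?_⟩
  intro f e h q hq q' hq'
  exact h _ (mem_of_mem_edgeSwaps hq).1 _ (mem_of_mem_edgeSwaps hq).2 _
    (mem_of_mem_edgeSwaps hq').1 _ (mem_of_mem_edgeSwaps hq').2

theorem flatMap_edgeSwaps_ne (E : List (Finset (Fin n))) :
    ∀ q ∈ E.flatMap edgeSwaps, q.1 ≠ q.2 := by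
  intro q hq
  obtain ⟨e, -, hq⟩ := List.mem_flatMap.1 hq
  exact edgeSwaps_ne hq

theorem isNoncrossingCyclic_leftToRightProd {E : List (Finset (Fin n))}
    (hE : E.Pairwise Precedes) : IsNoncrossingCyclic (leftToRightProd (E.map edgePerm)) := by
  rw [← swapProd_flatMap]
  exact ((uncrossedList_flatMap hE).swapProd_spec (flatMap_edgeSwaps_ne E)).1

theorem sameCycle_leftToRightProd {E : List (Finset (Fin n))} (hE : E.Pairwise Precedes)
    {e : Finset (Fin n)} (he : e ∈ E) {x y : Fin n} (hx : x ∈ e) (hy : y ∈ e) :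
    (leftToRightProd (E.map edgePerm)).SameCycle x y := by
  rw [← swapProd_flatMap]
  exact rel_of_edgeSwaps (SameCycle.equivalence _)
    (fun q hq => ((uncrossedList_flatMap hE).swapProd_spec (flatMap_edgeSwaps_ne E)).2.1 q
      (List.mem_flatMap.2 ⟨e, he, hq⟩)) x hx y hy

theorem rel_of_sameCycle_leftToRightProd {r : Fin n → Fin n → Prop} (hr : Equivalence r)
    {E : List (Finset (Fin n))} (hE : ∀ e ∈ E, ∀ x ∈ e, ∀ y ∈ e, r x y) {x y : Fin n}
    (h : (leftToRightProd (E.map edgePerm)).SameCycle x y) : r x y := by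
  rw [← swapProd_flatMap] at h
  refine rel_of_sameCycle_swapProd hr (fun q hq => ?_) h
  obtain ⟨e, he, hq⟩ := List.mem_flatMap.1 hq
  exact hE e he _ (mem_of_mem_edgeSwaps hq).1 _ (mem_of_mem_edgeSwaps hq).2

/-- Subadditivity gives one inequality. For the other, the concatenated transpositions of the
hyperedges form an uncrossed list, hence a shortest one, and each block is at least as long as the
reflection length of its factor. -/
theorem reflectionLength_leftToRightProd {E : List (Finset (Fin n))} (hE : E.Pairwise Precedes) :
    reflectionLength (leftToRightProd (E.map edgePerm)) =
      ((E.map edgePerm).map reflectionLength).sum := by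
  apply le_antisymm (reflectionLength_leftToRightProd_le _)
  have h1 := ((uncrossedList_flatMap hE).swapProd_spec (flatMap_edgeSwaps_ne E)).2.2
  rw [swapProd_flatMap, List.length_flatMap] at h1
  refine le_trans ?_ h1
  rw [List.map_map]
  refine List.sum_le_sum fun e _ => ?_
  rw [Function.comp_apply, ← swapProd_edgeSwaps]
  exact reflectionLength_swapProd_le fun q hq => edgeSwaps_ne hq

theorem isNoncrossingCyclic_edgePerm (e : Finset (Fin n)) : IsNoncrossingCyclic (edgePerm e) := by
  simpa [leftToRightProd] using isNoncrossingCyclic_leftToRightProd (List.pairwise_singleton _ e)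

theorem support_edgePerm {e : Finset (Fin n)} (he : 2 ≤ e.card) : (edgePerm e).support = e := by
  rw [edgePerm, List.support_formPerm_of_nodup _ (Finset.sort_nodup _ _), Finset.sort_toFinset]
  intro x hx
  have := congrArg List.length hx
  rw [Finset.length_sort, List.length_singleton] at this
  omega

theorem isCycle_edgePerm {e : Finset (Fin n)} (he : 2 ≤ e.card) : (edgePerm e).IsCycle :=
  List.isCycle_formPerm (Finset.sort_nodup _ _) (by rwa [Finset.length_sort])

/-- A noncrossing permutation with a single cycle is the one of the set of moved elements. -/
theorem IsNoncrossingCyclic.edgePerm_support {w : Perm (Fin n)} (hw : IsNoncrossingCyclic w)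
    (hc : w.IsCycle) : edgePerm w.support = w := by
  have hcard := hc.two_le_card_support
  refine (isNoncrossingCyclic_edgePerm _).eq_of_sameCycle_iff hw fun x y => ?_
  have key : ∀ u : Perm (Fin n), u.IsCycle → u.support = w.support →
      (u.SameCycle x y ↔ x = y ∨ x ∈ w.support ∧ y ∈ w.support) := by
    intro u hu hsu
    rw [← hsu, mem_support, mem_support]
    constructor
    · intro h
      by_cases hx : u x = x
      · exact Or.inl (h.eq_of_left hx)
      · exact Or.inr ⟨hx, fun hy => hx (h.apply_eq_self_iff.2 hy)⟩
    · rintro (rfl | ⟨hx, hy⟩)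
      · exact SameCycle.refl _ _
      · exact hu.sameCycle hx hy
  rw [key _ (isCycle_edgePerm hcard) (support_edgePerm hcard), key _ hc rfl]

/-- The factors of a reduced factorization of a noncrossing permutation into cycles are the cycles
of hyperedges each of which may precede the later ones. -/
theorem reduced_factorization_spec {L : List (Perm (Fin n))} (hc : ∀ s ∈ L, s.IsCycle)
    (hw : IsNoncrossingCyclic (leftToRightProd L))
    (hlen : reflectionLength (leftToRightProd L) = (L.map reflectionLength).sum) :
    (∀ s ∈ L, edgePerm s.support = s) ∧ (L.map support).Pairwise Precedes := by
  choose T hne hprod hT using exists_swapProd_eq (n := n)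
  have hflat : ∀ M : List (Perm (Fin n)), swapProd (M.flatMap T) = leftToRightProd M := by
    intro M
    induction M with
    | nil => rfl
    | cons s M ih => rw [List.flatMap_cons, swapProd_append, ih, hprod, leftToRightProd_cons]
  -- Since the lengths add up, concatenating shortest factorizations of the factors gives a shortest
  -- factorization of the product.
  have hu : UncrossedList (L.flatMap T) := by
    refine uncrossedList_of_length_eq (fun q hq => ?_) (by rwa [hflat]) ?_
    · obtain ⟨s, -, hq⟩ := List.mem_flatMap.1 hq
      exact hne s q hq
    · rw [hflat, hlen, List.length_flatMap]
      simp [hT]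
  rw [UncrossedList, List.pairwise_flatMap] at hu
  refine ⟨fun s hs => IsNoncrossingCyclic.edgePerm_support ?_ (hc s hs), ?_⟩
  · have := (UncrossedList.swapProd_spec (hu.1 s hs) (hne s)).1
    rwa [hprod] at this
  · rw [List.pairwise_map]
    refine hu.2.imp_of_mem ?_
    intro s t hs ht hst x hx y hy a ha b hb
    have hxy := (hc s hs).sameCycle (mem_support.1 hx) (mem_support.1 hy)
    have hab := (hc t ht).sameCycle (mem_support.1 ha) (mem_support.1 hb)
    rw [← hprod s] at hxy
    rw [← hprod t] at hab
    -- Only the transposed pairs are known to be uncrossed; the relation is extended to whole cycles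
    -- in one pair of arguments and then in the other.
    exact rel_of_sameCycle_swapProd (uncrossed_equivalence_left a b) (fun q hq =>
      rel_of_sameCycle_swapProd (uncrossed_equivalence_right q.1 q.2) (hst q hq) hab) hxy

/-! ### Geometry of the polygon -/

section Geometry

variable {p : Fin n → EuclideanSpace ℝ (Fin 2)}

/-- Twice the signed area of the triangle `p i, p j, p k`. -/
def signedArea (p : Fin n → EuclideanSpace ℝ (Fin 2)) (i j k : Fin n) : ℝ :=
  (p j 0 - p i 0) * (p k 1 - p i 1) - (p j 1 - p i 1) * (p k 0 - p i 0)

theorem signedArea_neg (hp : IsClockwiseConvexPolygon p) {i j k : Fin n} (h : Cyc i j k) :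
    signedArea p i j k < 0 := by
  rcases h with ⟨h1, h2⟩ | ⟨h1, h2⟩ | ⟨h1, h2⟩
  · exact hp.2 i j k h1 h2
  · have := hp.2 j k i h1 h2
    unfold signedArea
    linarith
  · have := hp.2 k i j h1 h2
    unfold signedArea
    linarith

theorem signedArea_swap (i j k : Fin n) : signedArea p i k j = -signedArea p i j k := by
  unfold signedArea
  ring

theorem signedArea_rotate (i j k : Fin n) : signedArea p j k i = signedArea p i j k := by
  unfold signedArea
  ring

theorem cyc_or_cyc {i j k : Fin n} (hij : i ≠ j) (hjk : j ≠ k) (hik : i ≠ k) :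
    Cyc i j k ∨ Cyc i k j := by
  simp only [Cyc, Fin.lt_def, ne_eq, Fin.ext_iff] at *; omega

theorem isLeftOf_iff (hp : IsClockwiseConvexPolygon p) {v a b : Fin n} :
    IsLeftOf p v a b ↔ Cyc v a b := by
  have hdef : IsLeftOf p v a b ↔ 0 < signedArea p v b a := Iff.rfl
  rw [hdef]
  constructor
  · intro h
    have hva : v ≠ a := by
      rintro rfl
      simp [signedArea] at h
    have hvb : v ≠ b := by
      rintro rfl
      simp [signedArea] at h
    have hab : a ≠ b := by
      rintro rfl
      apply h.ne'
      unfold signedArea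
      ring
    rcases cyc_or_cyc hva hab hvb with h' | h'
    · exact h'
    · exact absurd h (signedArea_neg hp h').not_gt
  · intro h
    rw [signedArea_swap]
    exact neg_pos.2 (signedArea_neg hp h)

theorem eq_or_eq_of_signedArea_eq_zero (hp : IsClockwiseConvexPolygon p) {x y v : Fin n}
    (hxy : x ≠ y) (h : signedArea p x y v = 0) : v = x ∨ v = y := by
  by_contra! hv
  rcases cyc_or_cyc hxy hv.2.symm hv.1.symm with h' | h'
  · exact (signedArea_neg hp h').ne h
  · have := signedArea_neg hp h'
    rw [signedArea_swap, h] at this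
    simp at this

/-- The hyperedges of a weakly noncrossing pair do not have crossing diagonals. -/
theorem WeaklyNoncrossing.not_crossing (hp : IsClockwiseConvexPolygon p) {e f : Finset (Fin n)}
    (h : WeaklyNoncrossing p e f) {a b x y : Fin n} (ha : a ∈ e) (hb : b ∈ e) (hx : x ∈ f)
    (hy : y ∈ f) (h1 : Cyc a x b) (h2 : Cyc b y a) : False := by
  have hdist : a ≠ b ∧ x ≠ y ∧ a ≠ x ∧ a ≠ y ∧ b ≠ x ∧ b ≠ y ∧ Cyc x b y ∧ Cyc y a x := by
    simp only [Cyc, Fin.lt_def, ne_eq, Fin.ext_iff] at *; omega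
  obtain ⟨hab, hxy, hax, hay, hbx, hby, h3, h4⟩ := hdist
  have s1 : 0 < signedArea p a b x := by
    rw [signedArea_swap]
    exact neg_pos.2 (signedArea_neg hp h1)
  have s2 : signedArea p a b y < 0 := by
    rw [← signedArea_rotate]
    exact signedArea_neg hp h2
  have s3 : 0 < signedArea p x y b := by
    rw [signedArea_swap]
    exact neg_pos.2 (signedArea_neg hp h3)
  have s4 : signedArea p x y a < 0 := by
    rw [← signedArea_rotate]
    exact signedArea_neg hp h4
  set s := signedArea p a b x - signedArea p a b y with hs
  have hs' : s = signedArea p x y b - signedArea p x y a := by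
    rw [hs]
    unfold signedArea
    ring
  have spos : 0 < s := by linarith
  -- The intersection of the two diagonals: on each of them the weights are proportional to the
  -- distances of its ends from the other diagonal.
  set q := (-signedArea p a b y / s) • p x + (signedArea p a b x / s) • p y with hq
  have hq' : q = (signedArea p x y b / s) • p a + (-signedArea p x y a / s) • p b := by
    ext i
    simp only [hq, PiLp.add_apply, PiLp.smul_apply, smul_eq_mul]
    rw [div_mul_eq_mul_div, div_mul_eq_mul_div, div_mul_eq_mul_div, div_mul_eq_mul_div,
      ← add_div, ← add_div]
    congr 1
    unfold signedArea
    fin_cases i <;> simp <;> ring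
  have hsub : ∀ (g : Finset (Fin n)), ∀ z ∈ g, p z ∈ convexHull ℝ (p '' (g : Set (Fin n))) :=
    fun g z hz => subset_convexHull ℝ _ (Set.mem_image_of_mem p (Finset.mem_coe.2 hz))
  have hqf : q ∈ convexHull ℝ (p '' (f : Set (Fin n))) := by
    refine (convex_convexHull ℝ _) (hsub _ _ hx)
      (hsub _ _ hy) (div_nonneg (by linarith) spos.le)
      (div_nonneg s1.le spos.le) ?_
    rw [← add_div, div_eq_one_iff_eq spos.ne', hs]
    ring
  have hqe : q ∈ convexHull ℝ (p '' (e : Set (Fin n))) := by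
    rw [hq']
    refine (convex_convexHull ℝ _) (hsub _ _ ha)
      (hsub _ _ hb) (div_nonneg s3.le spos.le)
      (div_nonneg (by linarith) spos.le) ?_
    rw [← add_div, div_eq_one_iff_eq spos.ne', hs']
    ring
  have hmem := Set.mem_inter hqe hqf
  rcases h with h | ⟨v, h⟩
  · rw [h] at hmem
    exact hmem
  rw [h, Set.mem_singleton_iff] at hmem
  have c0 : ∀ i, p v i = (-signedArea p a b y / s) * p x i + (signedArea p a b x / s) * p y i := by
    intro i
    rw [← hmem, hq]
    simp
  have c1 : ∀ i, p v i = (signedArea p x y b / s) * p a i + (-signedArea p x y a / s) * p b i := by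
    intro i
    rw [← hmem, hq']
    simp
  have t0 : -signedArea p a b y / s + signedArea p a b x / s = 1 := by
    rw [← add_div, div_eq_one_iff_eq spos.ne', hs]
    ring
  have t1 : signedArea p x y b / s + -signedArea p x y a / s = 1 := by
    rw [← add_div, div_eq_one_iff_eq spos.ne', hs']
    ring
  -- If the common point is a vertex, it lies on both diagonals and is therefore an end of both, but
  -- the four ends are distinct.
  have z0 : signedArea p x y v = 0 := by
    rw [signedArea, c0, c0]
    linear_combination ((p y 0 - p x 0) * p x 1 - (p y 1 - p x 1) * p x 0) * t0
  have z1 : signedArea p a b v = 0 := by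
    rw [signedArea, c1, c1]
    linear_combination ((p b 0 - p a 0) * p a 1 - (p b 1 - p a 1) * p a 0) * t1
  rcases eq_or_eq_of_signedArea_eq_zero hp hxy z0 with rfl | rfl <;>
    rcases eq_or_eq_of_signedArea_eq_zero hp hab z1 with h | h <;> simp_all

theorem WeaklyNoncrossing.eq_of_mem (hp : IsClockwiseConvexPolygon p) {e f : Finset (Fin n)}
    (h : WeaklyNoncrossing p e f) {u w : Fin n} (hu : u ∈ e) (hu' : u ∈ f) (hw : w ∈ e)
    (hw' : w ∈ f) : u = w := by
  have key : ∀ z, z ∈ e → z ∈ f → p z ∈ convexHull ℝ (p '' (e : Set (Fin n))) ∩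
      convexHull ℝ (p '' (f : Set (Fin n))) := fun z hz hz' =>
    ⟨subset_convexHull ℝ _ ⟨z, hz, rfl⟩, subset_convexHull ℝ _ ⟨z, hz', rfl⟩⟩
  have h1 := key u hu hu'
  have h2 := key w hw hw'
  rcases h with h | ⟨v, h⟩
  · rw [h] at h1
    exact h1.elim
  · rw [h, Set.mem_singleton_iff] at h1 h2
    exact hp.1 (h1.trans h2.symm)

theorem WeaklyNoncrossing.symm {e f : Finset (Fin n)} (h : WeaklyNoncrossing p e f) :
    WeaklyNoncrossing p f e := by
  unfold WeaklyNoncrossing at *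
  rwa [Set.inter_comm]

theorem WeaklyNoncrossing.precedes_of_disjoint (hp : IsClockwiseConvexPolygon p)
    {e f : Finset (Fin n)} (h : WeaklyNoncrossing p e f) (hd : Disjoint e f) : Precedes e f := by
  intro x hx y hy a ha b hb
  have h1 : ∀ z ∈ e, ∀ z' ∈ f, z ≠ z' := fun z hz z' hz' hzz =>
    Finset.disjoint_left.1 hd hz (hzz ▸ hz')
  have c1 := h1 x hx a ha
  have c2 := h1 x hx b hb
  have c3 := h1 y hy a ha
  have c4 := h1 y hy b hb
  have h2 := fun u w => h.not_crossing hp hx hy ha hb u w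
  have h3 := fun u w => h.not_crossing hp hx hy hb ha u w
  have h4 : ∀ A B : Prop, (A → B → False) → ¬ (A ∧ B) := fun A B h h' => h h'.1 h'.2
  replace h2 := h4 _ _ h2
  replace h3 := h4 _ _ h3
  clear h4 h1 hd h
  simp only [Cyc, Uncrossed, Fin.lt_def, ne_eq, Fin.ext_iff] at *; omega

/-- Transitivity in both pairs reduces everything to `Uncrossed v z v c`, that is, to `c` not lying
in `(v, z]`. The interval being closed at `z`, this also excludes a second common vertex. -/
theorem precedes_iff_of_mem {e f : Finset (Fin n)} {v : Fin n} (he : v ∈ e) (hf : v ∈ f) :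
    Precedes e f ↔ ∀ a ∈ e, a ≠ v → ∀ b ∈ f, b ≠ v → Cyc v a b := by
  constructor
  · intro h a ha hav b hb hbv
    have h1 := h v he a ha v hf b hb
    simp only [Cyc, Uncrossed, Fin.lt_def, ne_eq, Fin.ext_iff] at *; omega
  · intro h x hx y hy a ha b hb
    have key : ∀ z ∈ e, ∀ c ∈ f, Uncrossed v z v c := by
      intro z hz c hc
      by_cases hzv : z = v
      · exact hzv ▸ Uncrossed.refl_left _ _ _
      by_cases hcv : c = v
      · exact hcv ▸ Uncrossed.refl_right _ _ _
      have h1 := h z hz hzv c hc hcv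
      simp only [Cyc, Uncrossed, Fin.lt_def, ne_eq, Fin.ext_iff] at *; omega
    have e1 : Uncrossed x y v a := (key x hx a ha).swap_left.trans_left (key y hy a ha)
    have e2 : Uncrossed x y v b := (key x hx b hb).swap_left.trans_left (key y hy b hb)
    exact Uncrossed.trans_right e1.symm e2

theorem WeaklyNoncrossing.precedes_or_precedes (hp : IsClockwiseConvexPolygon p)
    {e f : Finset (Fin n)} (h : WeaklyNoncrossing p e f) {v : Fin n} (he : v ∈ e) (hf : v ∈ f) :
    Precedes e f ∨ Precedes f e := by
  by_contra! hcon
  rw [precedes_iff_of_mem he hf, precedes_iff_of_mem hf he] at hcon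
  push Not at hcon
  obtain ⟨⟨a, ha, hav, b, hb, hbv, h1⟩, b', hb', hbv', a', ha', hav', h2⟩ := hcon
  have hab : a ≠ b := fun hab => hav (h.eq_of_mem hp ha (hab ▸ hb) he hf)
  have hab' : a' ≠ b' := fun hab => hav' (h.eq_of_mem hp ha' (hab ▸ hb') he hf)
  have hab'' : a ≠ b' := fun hab => hav (h.eq_of_mem hp ha (hab ▸ hb') he hf)
  have h3 := (cyc_or_cyc hav.symm hab hbv.symm).resolve_left h1
  have h4 := (cyc_or_cyc hbv'.symm hab'.symm hav'.symm).resolve_left h2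
  -- Seen from `v`, the order is either `b, a, b'` or `a', b', a`; in both cases the diagonal from
  -- `v` to the middle vertex crosses the one joining the outer two.
  rcases cyc_or_cyc hav.symm hab'' hbv'.symm with h5 | h5
  · apply h.symm.not_crossing hp hb hb' ha he
    · clear h1 h2 h
      simp only [Cyc, Fin.lt_def] at *; omega
    · clear h1 h2 h
      simp only [Cyc, Fin.lt_def] at *; omega
  · apply h.not_crossing hp ha' ha hb' hf
    · clear h1 h2 h
      simp only [Cyc, Fin.lt_def] at *; omega
    · clear h1 h2 h
      simp only [Cyc, Fin.lt_def] at *; omega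

/-- A hyperedge that may precede `e` lies between two cyclically consecutive vertices of `e`. -/
theorem Precedes.exists_consecutive {e f : Finset (Fin n)} (h : Precedes f e) (he : 2 ≤ e.card)
    (hf : f.Nonempty) : ∃ v ∈ e, ∃ u ∈ e, v ≠ u ∧ (∀ x ∈ f, x = v ∨ Cyc v x u) ∧
      ∀ a ∈ e, a = v ∨ a = u ∨ Cyc u a v := by
  obtain ⟨x, hx⟩ := hf
  have hne : e.Nonempty := Finset.card_pos.1 (by omega)
  have key : ∃ v ∈ e, ∃ u ∈ e, v ≠ u ∧ (x = v ∨ Cyc v x u) ∧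
      ∀ a ∈ e, a = v ∨ a = u ∨ Cyc u a v := by
    by_cases h1 : ∃ a ∈ e, a ≤ x ∧ ∃ b ∈ e, x < b
    · obtain ⟨a, ha, hax, b, hb, hxb⟩ := h1
      have hA : (e.filter (· ≤ x)).Nonempty := ⟨a, by simp [ha, hax]⟩
      have hB : (e.filter (x < ·)).Nonempty := ⟨b, by simp [hb, hxb]⟩
      obtain ⟨hv, hvx⟩ := Finset.mem_filter.1 (Finset.max'_mem _ hA)
      obtain ⟨hu, hxu⟩ := Finset.mem_filter.1 (Finset.min'_mem _ hB)
      have hmax : ∀ c ∈ e, c ≤ x → c ≤ (e.filter (· ≤ x)).max' hA := fun c hc hcx =>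
        Finset.le_max' _ _ (by simp [hc, hcx])
      have hmin : ∀ c ∈ e, x < c → (e.filter (x < ·)).min' hB ≤ c := fun c hc hcx =>
        Finset.min'_le _ _ (by simp [hc, hcx])
      refine ⟨_, hv, _, hu, (hvx.trans_lt hxu).ne, ?_, fun c hc => ?_⟩
      · simp only [Cyc, Fin.lt_def, Fin.le_def, Fin.ext_iff] at *; omega
      · have h3 := hmax c hc
        have h4 := hmin c hc
        simp only [Cyc, Fin.lt_def, Fin.le_def, Fin.ext_iff] at *; omega
    -- Here `x` lies before or after all of `e`, or at its maximum, so the gap containing it wraps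
    -- around from the largest to the smallest vertex.
    · have hlt := Finset.min'_lt_max'_of_card e (by omega)
      have hmin := fun c hc => Finset.min'_le e c hc
      have hmax := fun c hc => Finset.le_max' e c hc
      push Not at h1
      have h2 := h1 _ (e.min'_mem hne)
      refine ⟨_, e.max'_mem hne, _, e.min'_mem hne, hlt.ne', ?_, fun c hc => ?_⟩
      · have h3 := fun h => h2 h _ (e.max'_mem hne)
        simp only [Cyc, Fin.lt_def, Fin.le_def, Fin.ext_iff] at *; omega
      · have h3 := hmin c hc
        have h4 := hmax c hc
        simp only [Cyc, Fin.lt_def, Fin.le_def, Fin.ext_iff] at *; omega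
  obtain ⟨v, hv, u, hu, hvu, h1, h2⟩ := key
  refine ⟨v, hv, u, hu, hvu, fun y hy => ?_, h2⟩
  -- If `y` lay outside `[v, u)`, the interval `(x, y]` would contain `u` but not `v`.
  have h3 := h x hx y hy v hv u hu
  clear h h2
  simp only [Cyc, Uncrossed, Fin.lt_def, ne_eq, Fin.ext_iff] at *; omega

theorem convex_insert_halfSpace {E : Type*} [AddCommGroup E] [Module ℝ E] (l : E →ₗ[ℝ] ℝ) (o : E) :
    Convex ℝ {q | q = o ∨ l o < l q} := by
  intro x hx y hy s t hs ht hst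
  have hle : ∀ z, (z = o ∨ l o < l z) → l o ≤ l z := by
    rintro z (rfl | hz)
    · exact le_rfl
    · exact hz.le
  have hval : l (s • x + t • y) - l o = s * (l x - l o) + t * (l y - l o) := by
    rw [map_add, map_smul, map_smul, smul_eq_mul, smul_eq_mul]
    linear_combination l o * hst
  rcases hs.eq_or_lt with rfl | hs
  · obtain rfl : t = 1 := by linarith
    simpa using hy
  rcases ht.eq_or_lt with rfl | ht
  · obtain rfl : s = 1 := by linarith
    simpa using hx
  have hx' := mul_nonneg hs.le (sub_nonneg.2 (hle x hx))
  have hy' := mul_nonneg ht.le (sub_nonneg.2 (hle y hy))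
  rcases hx with rfl | hx
  · rcases hy with rfl | hy
    · left
      rw [← add_smul, hst, one_smul]
    · right
      have := mul_pos ht (sub_pos.2 hy)
      linarith
  · right
    have := mul_pos hs (sub_pos.2 hx)
    linarith

/-- The line through two consecutive vertices `v`, `u` of `e` separates the hulls: that of `e` lies
in a closed half-plane, and that of `f` in the opposite open one together with the point `p v`. -/
theorem Precedes.weaklyNoncrossing (hp : IsClockwiseConvexPolygon p) {e f : Finset (Fin n)}
    (h : Precedes f e) (he : 2 ≤ e.card) (hf : f.Nonempty) : WeaklyNoncrossing p f e := by
  obtain ⟨v, -, u, -, -, h1, h2⟩ := h.exists_consecutive he hf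
  let l : EuclideanSpace ℝ (Fin 2) →ₗ[ℝ] ℝ :=
    { toFun := fun q => (p u 0 - p v 0) * q 1 - (p u 1 - p v 1) * q 0
      map_add' := fun q r => by
        simp only [PiLp.add_apply]
        ring
      map_smul' := fun c q => by
        simp only [PiLp.smul_apply, smul_eq_mul, RingHom.id_apply]
        ring }
  have hl : ∀ z, l (p z) - l (p v) = signedArea p v u z := by
    intro z
    simp only [l, LinearMap.coe_mk, AddHom.coe_mk, signedArea]
    ring
  have hf' : convexHull ℝ (p '' (f : Set (Fin n))) ⊆ {q | q = p v ∨ l (p v) < l q} := by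
    refine convexHull_min ?_ (convex_insert_halfSpace l (p v))
    rintro _ ⟨x, hx, rfl⟩
    rcases h1 x hx with rfl | hx
    · exact Or.inl rfl
    · right
      have := signedArea_neg hp hx
      have h3 := hl x
      rw [signedArea_swap] at h3
      linarith
  have he' : convexHull ℝ (p '' (e : Set (Fin n))) ⊆ {q | l q ≤ l (p v)} := by
    refine convexHull_min ?_ (convex_halfSpace_le l.isLinear _)
    rintro _ ⟨a, ha, rfl⟩
    have h3 := hl a
    rw [Set.mem_ofPred_eq]
    rcases h2 a ha with rfl | rfl | ha
    · exact le_rfl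
    · have : signedArea p v a a = 0 := by
        unfold signedArea
        ring
      linarith
    · have := signedArea_neg hp ha
      rw [signedArea_rotate] at this
      linarith
  have hsub : convexHull ℝ (p '' (f : Set (Fin n))) ∩ convexHull ℝ (p '' (e : Set (Fin n))) ⊆
      {p v} := by
    rintro q ⟨hqf, hqe⟩
    rcases hf' hqf with hq | hq
    · exact hq
    · exact absurd (he' hqe) hq.not_ge
  rcases Set.subset_singleton_iff_eq.1 hsub with h3 | h3
  · exact Or.inl h3
  · exact Or.inr ⟨v, h3⟩

/-! ### The hyperedge poset and its linear extensions -/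

theorem HGraph.localLT_iff (hp : IsClockwiseConvexPolygon p) {τ : HGraph n} {v : Fin n}
    {e f : Finset (Fin n)} : τ.LocalLT p v e f ↔
      e ∈ τ.edges ∧ f ∈ τ.edges ∧ e ≠ f ∧ v ∈ e ∧ v ∈ f ∧ Precedes e f := by
  unfold HGraph.LocalLT
  refine and_congr_right fun _ => and_congr_right fun _ => and_congr_right fun _ =>
    and_congr_right fun he => and_congr_right fun hf => ?_
  rw [precedes_iff_of_mem he hf]
  simp only [isLeftOf_iff hp]

theorem exists_mem_ne_of_two_le {e : Finset (Fin n)} (he : 2 ≤ e.card) (v : Fin n) :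
    ∃ a ∈ e, a ≠ v :=
  Finset.exists_mem_ne (by omega) v

theorem not_precedes_of_precedes {e f : Finset (Fin n)} (he : 2 ≤ e.card) (hf : 2 ≤ f.card)
    {v : Fin n} (hve : v ∈ e) (hvf : v ∈ f) (h : Precedes e f) : ¬ Precedes f e := by
  intro h'
  obtain ⟨a, ha, hav⟩ := exists_mem_ne_of_two_le he v
  obtain ⟨b, hb, hbv⟩ := exists_mem_ne_of_two_le hf v
  have h1 := (precedes_iff_of_mem hve hvf).1 h a ha hav b hb hbv
  have h2 := (precedes_iff_of_mem hvf hve).1 h' b hb hbv a ha hav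
  simp only [Cyc, Fin.lt_def] at *; omega

theorem HGraph.LocalLT.trans (hp : IsClockwiseConvexPolygon p) {τ : HGraph n} {v : Fin n}
    {e f g : Finset (Fin n)} (h : τ.LocalLT p v e f) (h' : τ.LocalLT p v f g) :
    τ.LocalLT p v e g := by
  rw [HGraph.localLT_iff hp] at *
  obtain ⟨he, hf, hef, hve, hvf, h⟩ := h
  obtain ⟨-, hg, hfg, -, hvg, h'⟩ := h'
  refine ⟨he, hg, ?_, hve, hvg, ?_⟩
  · rintro rfl
    exact not_precedes_of_precedes (τ.two_le_card _ he) (τ.two_le_card _ hf) hve hvf h h'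
  · rw [precedes_iff_of_mem hve hvg]
    intro a ha hav c hc hcv
    obtain ⟨b, hb, hbv⟩ := exists_mem_ne_of_two_le (τ.two_le_card _ hf) v
    have h1 := (precedes_iff_of_mem hve hvf).1 h a ha hav b hb hbv
    have h2 := (precedes_iff_of_mem hvf hvg).1 h' b hb hbv c hc hcv
    simp only [Cyc, Fin.lt_def] at *; omega

/-- In a finite order the covering relations generate all relations: induction on the number of
hyperedges strictly in between. -/
theorem HGraph.LocalLT.posetLE (hp : IsClockwiseConvexPolygon p) {τ : HGraph n} {v : Fin n}
    {e f : Finset (Fin n)} (h : τ.LocalLT p v e f) : τ.PosetLE p e f := by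
  classical
  induction hm : (τ.edges.filter fun g => τ.LocalLT p v e g ∧ τ.LocalLT p v g f).card
    using Nat.strong_induction_on generalizing e f with
  | _ m ih =>
    by_cases hcov : ∀ g, ¬ (τ.LocalLT p v e g ∧ τ.LocalLT p v g f)
    · exact Relation.ReflTransGen.single ⟨v, h, hcov⟩
    push Not at hcov
    obtain ⟨g, h1, h2⟩ := hcov
    have hg : g ∈ τ.edges.filter fun g => τ.LocalLT p v e g ∧ τ.LocalLT p v g f :=
      Finset.mem_filter.2 ⟨h1.2.1, h1, h2⟩
    refine (ih _ ?_ h1 rfl).trans (ih _ ?_ h2 rfl) <;> rw [← hm] <;> apply Finset.card_lt_card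
    · refine (Finset.ssubset_iff_of_subset fun k hk => ?_).2 ⟨g, hg, fun hk => ?_⟩
      · rw [Finset.mem_filter] at hk ⊢
        exact ⟨hk.1, hk.2.1, hk.2.2.trans hp h2⟩
      · exact (Finset.mem_filter.1 hk).2.2.2.2.1 rfl
    · refine (Finset.ssubset_iff_of_subset fun k hk => ?_).2 ⟨g, hg, fun hk => ?_⟩
      · rw [Finset.mem_filter] at hk ⊢
        exact ⟨hk.1, h1.trans hp hk.2.1, hk.2.2⟩
      · exact (Finset.mem_filter.1 hk).2.1.2.2.1 rfl

theorem precedes_of_idxOf_lt {E : List (Finset (Fin n))} (hE : E.Pairwise Precedes)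
    {e f : Finset (Fin n)} (hf : f ∈ E) (h : E.idxOf e < E.idxOf f) : Precedes e f := by
  have hf' := List.idxOf_lt_length_iff.2 hf
  have := List.pairwise_iff_getElem.1 hE _ _ (h.trans hf') hf' h
  simpa using this

/-- The properly ordered noncrossing hypergraphs in combinatorial terms. -/
theorem proper_iff_pairwise (hp : IsClockwiseConvexPolygon p) (τ : HGraph n)
    {E : List (Finset (Fin n))} (hnd : E.Nodup) (hE : ∀ e, e ∈ E ↔ e ∈ τ.edges) :
    (τ.IsNoncrossing p ∧ ∀ e ∈ τ.edges, ∀ f ∈ τ.edges, τ.PosetLE p e f →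
      E.idxOf e ≤ E.idxOf f) ↔ E.Pairwise Precedes := by
  constructor
  · rintro ⟨hnc, hord⟩
    rw [List.pairwise_iff_getElem]
    intro i j hi hj hij
    have hei := (hE _).1 (E.getElem_mem hi)
    have hej := (hE _).1 (E.getElem_mem hj)
    have hne : E[i] ≠ E[j] := fun h => hij.ne ((hnd.getElem_inj_iff).1 h)
    have hw := hnc _ hei _ hej hne
    by_cases hd : Disjoint E[i] E[j]
    · exact hw.precedes_of_disjoint hp hd
    obtain ⟨v, hvi, hvj⟩ := Finset.not_disjoint_iff.1 hd
    refine (hw.precedes_or_precedes hp hvi hvj).resolve_right fun h => ?_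
    have := hord _ hej _ hei
      (((HGraph.localLT_iff hp).2 ⟨hej, hei, hne.symm, hvj, hvi, h⟩).posetLE hp)
    rw [hnd.idxOf_getElem, hnd.idxOf_getElem] at this
    omega
  · intro hpw
    have hne : ∀ e ∈ τ.edges, e.Nonempty := fun e he =>
      Finset.card_pos.1 (lt_of_lt_of_le two_pos (τ.two_le_card e he))
    have hlt : ∀ e ∈ τ.edges, ∀ f ∈ τ.edges, e ≠ f → Precedes e f ∨ Precedes f e := by
      intro e he f hf hef
      rcases lt_trichotomy (E.idxOf e) (E.idxOf f) with h | h | h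
      · exact Or.inl (precedes_of_idxOf_lt hpw ((hE f).2 hf) h)
      · exact absurd ((List.idxOf_inj ((hE e).2 he)).1 h) hef
      · exact Or.inr (precedes_of_idxOf_lt hpw ((hE e).2 he) h)
    refine ⟨fun e he f hf hef => ?_, fun e _ f hf h => ?_⟩
    · rcases hlt e he f hf hef with h | h
      · exact h.weaklyNoncrossing hp (τ.two_le_card f hf) (hne e he)
      · exact (h.weaklyNoncrossing hp (τ.two_le_card e he) (hne f hf)).symm
    · clear hf
      induction h with
      | refl => exact le_rfl
      | tail _ hbc ih =>
        obtain ⟨v, hbc, -⟩ := hbc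
        obtain ⟨hb, hc, -, hvb, hvc, h⟩ := (HGraph.localLT_iff hp).1 hbc
        refine ih.trans (not_lt.1 fun hlt => ?_)
        exact not_precedes_of_precedes (τ.two_le_card _ hb) (τ.two_le_card _ hc) hvb hvc h
          (precedes_of_idxOf_lt hpw ((hE _).2 hb) hlt)

end Geometry

/-- A set with two distinct elements never precedes itself, so no repetition can occur. -/
theorem pairwise_precedes_nodup {E : List (Finset (Fin n))} (hE : E.Pairwise Precedes)
    (h2 : ∀ e ∈ E, 2 ≤ e.card) : E.Nodup := by
  refine hE.imp_of_mem fun {e f} he _ h hef => ?_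
  subst hef
  obtain ⟨a, ha, b, hb, hab⟩ := Finset.one_lt_card.1 (h2 e he)
  exact not_uncrossed_self hab (h a ha b hb a ha b hb)

/-- In a simple cycle take the hyperedge latest in the order, joining `v i` and `v (i + 1)`. All
others precede it, so walking along them from `v (i + 1)` back to `v i` stays in one class of
`Uncrossed · · (v i) (v (i + 1))`, although these two vertices are in different classes. -/
theorem isHyperforest_of_pairwise (τ : HGraph n) {E : List (Finset (Fin n))}
    (hE : ∀ e, e ∈ E ↔ e ∈ τ.edges) (hpw : E.Pairwise Precedes) : τ.IsHyperforest := by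
  rintro ⟨k, hk, v, e, hvk, hv, he, h⟩
  obtain ⟨i, hi, hmax⟩ := Finset.exists_max_image (Finset.range k) (fun i => E.idxOf (e i))
    ⟨0, Finset.mem_range.2 (by omega)⟩
  rw [Finset.mem_range] at hi
  obtain ⟨-, hvi, hvi'⟩ := h i hi
  have hr := uncrossed_equivalence_left (v i) (v (i + 1))
  have hstep : ∀ j < k, j ≠ i → Uncrossed (v j) (v (j + 1)) (v i) (v (i + 1)) := by
    intro j hj hji
    obtain ⟨hej, hvj, hvj'⟩ := h j hj
    have hlt : E.idxOf (e j) < E.idxOf (e i) := by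
      refine lt_of_le_of_ne (hmax j (Finset.mem_range.2 hj)) fun heq => ?_
      exact hji (he hj hi ((List.idxOf_inj ((hE _).2 hej)).1 heq))
    have hi' := List.idxOf_lt_length_iff.2 ((hE _).2 (h i hi).1)
    have := List.pairwise_iff_getElem.1 hpw _ _ (hlt.trans hi') hi' hlt
    simp only [List.getElem_idxOf] at this
    exact this _ hvj _ hvj' _ hvi _ hvi'
  have h1 : ∀ j, j ≤ i → Uncrossed (v 0) (v j) (v i) (v (i + 1)) := by
    intro j hj
    induction j with
    | zero => exact hr.refl _
    | succ j ih => exact hr.trans (ih (by omega)) (hstep j (by omega) (by omega))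
  have h2 : ∀ j, i + 1 ≤ j → j ≤ k → Uncrossed (v (i + 1)) (v j) (v i) (v (i + 1)) := by
    intro j hj
    induction j, hj using Nat.le_induction with
    | base => exact fun _ => hr.refl _
    | succ j hj ih => exact fun hjk => hr.trans (ih (by omega)) (hstep j (by omega) (by omega))
  have h3 := h2 k (by omega) le_rfl
  rw [hvk] at h3
  refine not_uncrossed_self (fun heq => ?_) (hr.symm (hr.trans h3 (h1 i le_rfl)))
  rcases Nat.lt_or_ge (i + 1) k with hik | hik
  · have := hv hi hik heq
    omega
  -- Injectivity holds only for indices below `k`, so `v k` has to be read as `v 0`; then `i = 0`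
  -- and `k = 1`, against `2 ≤ k`.
  · have hik' : i + 1 = k := by omega
    rw [hik', hvk] at heq
    have := hv hi (show 0 ∈ Set.Iio k from Set.mem_Iio.2 (by omega)) heq
    omega

/-! ### Permutations of partitions -/

theorem partitionPerm_eq (π : HGraph n) (hπ : π.IsPartition) :
    partitionPerm π hπ = leftToRightProd (π.edges.toList.map edgePerm) := by
  classical
  -- The reversed list matches the reversal built into `leftToRightProd`.
  have hl : π.edges = π.edges.toList.reverse.toFinset := by
    rw [List.toFinset_reverse, Finset.toList_toFinset]
  rw [partitionPerm, leftToRightProd, ← List.map_reverse,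
    ← Finset.noncommProd_toFinset _ _ _ (List.nodup_reverse.2 π.edges.nodup_toList)]
  exact Finset.noncommProd_congr hl (fun _ _ => rfl) _

theorem pairwise_precedes_toList {π : HGraph n}
    (h : ∀ e ∈ π.edges, ∀ f ∈ π.edges, e ≠ f → Precedes e f) :
    π.edges.toList.Pairwise Precedes :=
  π.edges.nodup_toList.imp_of_mem fun he hf hef =>
    h _ (Finset.mem_toList.1 he) _ (Finset.mem_toList.1 hf) hef

theorem IsNoncrossingPerm.isNoncrossingCyclic {p : Fin n → EuclideanSpace ℝ (Fin 2)}
    (hp : IsClockwiseConvexPolygon p) {σ : Perm (Fin n)} (hσ : IsNoncrossingPerm p σ) :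
    IsNoncrossingCyclic σ := by
  obtain ⟨π, hπ, hnc, rfl⟩ := hσ
  rw [partitionPerm_eq]
  exact isNoncrossingCyclic_leftToRightProd (pairwise_precedes_toList fun e he f hf hef =>
    (hnc e he f hf hef).precedes_of_disjoint hp (hπ e he f hf hef))

theorem HGraph.mem_component {τ : HGraph n} {v w : Fin n} :
    w ∈ τ.component v ↔ τ.Reachable v w := by
  simp [HGraph.component]

theorem HGraph.reachable_equivalence (τ : HGraph n) : Equivalence τ.Reachable :=
  ⟨fun _ => Relation.ReflTransGen.refl, HGraph.Reachable.symm, Relation.ReflTransGen.trans⟩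

theorem HGraph.mem_partition_edges {τ : HGraph n} {e : Finset (Fin n)} :
    e ∈ τ.partition.edges ↔ (∃ v, τ.component v = e) ∧ 2 ≤ e.card := by
  classical
  simp [HGraph.partition]

/-- The noncrossing permutation of a hypergraph is the product of its cycles in every proper
order. -/
theorem noncrossingPerm_eq (τ : HGraph n) {E : List (Finset (Fin n))}
    (hE : ∀ e, e ∈ E ↔ e ∈ τ.edges) (hpw : E.Pairwise Precedes) :
    τ.noncrossingPerm = leftToRightProd (E.map edgePerm) := by
  set w := leftToRightProd (E.map edgePerm) with hw
  have hnc : IsNoncrossingCyclic w := isNoncrossingCyclic_leftToRightProd hpw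
  -- The cycles of the product are the connected components; two noncrossing permutations with these
  -- cycles must agree.
  have hreach : ∀ x y, τ.Reachable x y ↔ w.SameCycle x y := by
    intro x y
    constructor
    · intro h
      induction h with
      | refl => exact SameCycle.refl _ _
      | tail _ h ih =>
        obtain ⟨e, he, hb, hc⟩ := h
        exact ih.trans (sameCycle_leftToRightProd hpw ((hE e).2 he) hb hc)
    · exact rel_of_sameCycle_leftToRightProd τ.reachable_equivalence fun e he a ha b hb =>
        Relation.ReflTransGen.single ⟨e, (hE e).1 he, ha, hb⟩
  have hprec : τ.partition.edges.toList.Pairwise Precedes := by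
    refine pairwise_precedes_toList fun e he f hf hef x hx y hy a ha b hb => ?_
    have hdisj := τ.isPartition_partition e he f hf hef
    obtain ⟨⟨u, rfl⟩, -⟩ := HGraph.mem_partition_edges.1 he
    obtain ⟨⟨v, rfl⟩, -⟩ := HGraph.mem_partition_edges.1 hf
    have hx' := (hreach _ _).1 (HGraph.mem_component.1 hx)
    have hy' := (hreach _ _).1 (HGraph.mem_component.1 hy)
    have ha' := (hreach _ _).1 (HGraph.mem_component.1 ha)
    have hb' := (hreach _ _).1 (HGraph.mem_component.1 hb)
    refine hnc.uncrossed (hx'.symm.trans hy') (ha'.symm.trans hb') fun hxa => ?_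
    exact Finset.disjoint_left.1 hdisj
      (HGraph.mem_component.2 ((hreach _ _).2 (hx'.trans hxa))) ha
  rw [HGraph.noncrossingPerm, partitionPerm_eq]
  refine (isNoncrossingCyclic_leftToRightProd hprec).eq_of_sameCycle_iff hnc fun x y => ?_
  rw [← hreach]
  constructor
  · refine rel_of_sameCycle_leftToRightProd τ.reachable_equivalence fun e he a ha b hb => ?_
    obtain ⟨⟨u, rfl⟩, -⟩ := HGraph.mem_partition_edges.1 (Finset.mem_toList.1 he)
    exact (HGraph.mem_component.1 ha).symm.trans (HGraph.mem_component.1 hb)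
  · intro h
    rcases eq_or_ne x y with rfl | hxy
    · exact SameCycle.refl _ _
    have hx : x ∈ τ.component x := HGraph.mem_component.2 Relation.ReflTransGen.refl
    have hy : y ∈ τ.component x := HGraph.mem_component.2 h
    refine sameCycle_leftToRightProd hprec (e := τ.component x) (Finset.mem_toList.2 ?_) hx hy
    exact HGraph.mem_partition_edges.2 ⟨⟨x, rfl⟩, Finset.one_lt_card.2 ⟨x, hx, y, hy, hxy⟩⟩

/-! ### The bijection -/

theorem IsReducedIrreducibleFactorization.spec {σ : Perm (Fin n)} (hσ : IsNoncrossingCyclic σ)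
    {L : List (Perm (Fin n))} (hL : IsReducedIrreducibleFactorization σ L) :
    (L.map support).map edgePerm = L ∧ (L.map support).Pairwise Precedes := by
  obtain ⟨hc, rfl, hlen⟩ := hL
  obtain ⟨h1, h2⟩ := reduced_factorization_spec hc hσ hlen
  refine ⟨?_, h2⟩
  rw [List.map_map]
  conv_rhs => rw [← List.map_id L]
  exact List.map_congr_left h1

theorem two_le_card_of_mem_map_support {L : List (Perm (Fin n))} (hL : ∀ s ∈ L, s.IsCycle) :
    ∀ e ∈ L.map support, 2 ≤ e.card := by
  intro e he
  obtain ⟨s, hs, rfl⟩ := List.mem_map.1 he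
  exact (hL s hs).two_le_card_support

/-- The ordered hyperforest of a list of hyperedges each of which may precede the later ones. -/
def orderedHyperforestOfList (E : List (Finset (Fin n))) (h2 : ∀ e ∈ E, 2 ≤ e.card)
    (hE : E.Pairwise Precedes) : OrderedHyperforest n where
  edges := E.toFinset
  two_le_card := fun e he => h2 e (List.mem_toFinset.1 he)
  isHyperforest := isHyperforest_of_pairwise _ (fun _ => List.mem_toFinset.symm) hE
  order := E
  nodup := pairwise_precedes_nodup hE h2
  mem_order := fun _ => List.mem_toFinset.symm

theorem OrderedHyperforest.ext_of_order {τ τ' : OrderedHyperforest n} (h : τ.order = τ'.order) :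
    τ = τ' := by
  refine OrderedHyperforest.ext ?_ h
  ext1 e
  rw [← τ.mem_order, ← τ'.mem_order, h]

theorem OrderedHyperforest.isProperNoncrossing_iff {p : Fin n → EuclideanSpace ℝ (Fin 2)}
    (hp : IsClockwiseConvexPolygon p) (τ : OrderedHyperforest n) :
    τ.IsProperNoncrossing p ↔ τ.order.Pairwise Precedes :=
  proper_iff_pairwise hp τ.toHGraph τ.nodup τ.mem_order

theorem OrderedHyperforest.two_le_card_of_mem_order (τ : OrderedHyperforest n) :
    ∀ e ∈ τ.order, 2 ≤ e.card :=
  fun e he => τ.two_le_card e ((τ.mem_order e).1 he)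

theorem map_support_map_edgePerm {E : List (Finset (Fin n))} (hE : ∀ e ∈ E, 2 ≤ e.card) :
    (E.map edgePerm).map support = E := by
  rw [List.map_map]
  conv_rhs => rw [← List.map_id E]
  exact List.map_congr_left fun e he => support_edgePerm (hE e he)

theorem isReducedIrreducibleFactorization_map_edgePerm {E : List (Finset (Fin n))}
    (h2 : ∀ e ∈ E, 2 ≤ e.card) (hE : E.Pairwise Precedes) :
    IsReducedIrreducibleFactorization (leftToRightProd (E.map edgePerm)) (E.map edgePerm) := by
  refine ⟨fun s hs => ?_, rfl, reflectionLength_leftToRightProd hE⟩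
  obtain ⟨e, he, rfl⟩ := List.mem_map.1 hs
  exact isCycle_edgePerm (h2 e he)

/-- The bijection between the reduced factorizations of a noncrossing permutation into irreducible
permutations and the properly ordered noncrossing hyperforests. -/
def factorizationEquiv {p : Fin n → EuclideanSpace ℝ (Fin 2)} (hp : IsClockwiseConvexPolygon p)
    {σ : Perm (Fin n)} (hσ : IsNoncrossingCyclic σ) :
    {L : List (Perm (Fin n)) // IsReducedIrreducibleFactorization σ L} ≃
      {τ : OrderedHyperforest n // τ.IsProperNoncrossing p ∧ τ.toHGraph.noncrossingPerm = σ} where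
  toFun L := ⟨orderedHyperforestOfList (L.1.map support)
      (two_le_card_of_mem_map_support L.2.1) (L.2.spec hσ).2,
    (OrderedHyperforest.isProperNoncrossing_iff hp _).2 (L.2.spec hσ).2, by
      rw [noncrossingPerm_eq (E := L.1.map support) _ (fun _ => List.mem_toFinset.symm)
        (L.2.spec hσ).2, (L.2.spec hσ).1, L.2.2.1]⟩
  invFun τ := ⟨τ.1.order.map edgePerm, by
    have hpw := (OrderedHyperforest.isProperNoncrossing_iff hp _).1 τ.2.1
    have h := noncrossingPerm_eq τ.1.toHGraph τ.1.mem_order hpw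
    rw [τ.2.2] at h
    have key :=
      isReducedIrreducibleFactorization_map_edgePerm τ.1.two_le_card_of_mem_order hpw
    rwa [← h] at key⟩
  left_inv L := Subtype.ext (L.2.spec hσ).1
  right_inv τ := Subtype.ext (OrderedHyperforest.ext_of_order
    (map_support_map_edgePerm τ.1.two_le_card_of_mem_order))

end NCHyperforest

theorem mainTheorem5 (n : ℕ) (p : Fin n → EuclideanSpace ℝ (Fin 2))
    (hp : NCHyperforest.IsClockwiseConvexPolygon p)
    (σ : Equiv.Perm (Fin n)) (hσ : NCHyperforest.IsNoncrossingPerm p σ) :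
    ∃ Φ : {L : List (Equiv.Perm (Fin n)) //
            NCHyperforest.IsReducedIrreducibleFactorization σ L} ≃
          {τ : NCHyperforest.OrderedHyperforest n //
            τ.IsProperNoncrossing p ∧ τ.toHGraph.noncrossingPerm = σ},
      (∀ L, (Φ L).1.order = L.1.map Equiv.Perm.support) ∧
      (∀ τ, (Φ.symm τ).1 = τ.1.order.map NCHyperforest.edgePerm) :=
  ⟨NCHyperforest.factorizationEquiv hp (hσ.isNoncrossingCyclic hp), fun _ => rfl, fun _ => rfl⟩
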